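/- For a real number $r>0$ and a compact Hausdorff space $S$, let $\mathbb{Z}((T))_r(S)$ be the ring of Laurent series $\sum_{n\gg-\infty}a_nT^n$ with coefficients $a_n\in C(S,\mathbb{Z})$ for which there is a constant $c>0$ such that $\sum_n|a_n(s)|r^n\le c$ for all $s\in S$. With pullback of functions as restriction maps, $S\mapsto\mathbb{Z}((T))_r(S)$ is a condensed ring $\mathbb{Z}((T))_r$. Let $\underline{\mathbb{R}}$ be the condensed ring $S\mapsto C(S,\mathbb{R})$. Let $\mathbb{Z}((T))_{>r}$ be the ring of Laurent series $\sum_{n\gg-\infty}a_nT^n$ with $a_n\in\mathbb{Z}$ for which there is $t>r$ with $|a_n|t^n\to0$ as $n\to\infty$; its elements are regarded as elements of $\mathbb{Z}((T))_r(S)$ with constant coefficients, for every $S$. Theorem. Let $0<r'<r<1$, and let $$\theta_{r'}\colon \mathbb{Z}((T))_r\to\underline{\mathbb{R}},\qquad \sum a_nT^n\mapsto\sum a_n(r')^n .$$ Then $\theta_{r'}$ is an epimorphism of condensed abelian groups; equivalently, it is surjective on $S$-valued points for every extremally disconnected compact Hausdorff space $S$. Moreover, there is a non-zero-divisor $f_{r'}\in\mathbb{Z}((T))_{>r}$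 such that for every compact Hausdorff space $S$ (in particular every extremally disconnected one) $f_{r'}$ is a non-zero-divisor of the ring $\mathbb{Z}((T))_r(S)$, and the kernel of $\theta_{r'}\colon\mathbb{Z}((T))_r(S)\to C(S,\mathbb{R})$ is the principal ideal generated by $f_{r'}$. Consequently, $$0\to\mathbb{Z}((T))_r\xrightarrow{\ \cdot f_{r'}\ }\mathbb{Z}((T))_r\xrightarrow{\ \theta_{r'}\ }\underline{\mathbb{R}}\to0$$ is a short exact sequence of condensed abelian groups. -/

import Mathlib

universe u

open CategoryTheory Opposite

namespace CondensedLaurent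

open Filter Topology

/-! ### Weighted `ℓ¹`-norms of integral Laurent series -/

/-- `NormLE x c f` says that `f = ∑ aₙ Tⁿ` satisfies `∑ |aₙ| xⁿ ≤ c` (in particular the series
converges). -/
def NormLE (x c : ℝ) (f : LaurentSeries ℤ) : Prop :=
  Summable (fun n : ℤ => |(f.coeff n : ℝ)| * x ^ n) ∧ ∑' n : ℤ, |(f.coeff n : ℝ)| * x ^ n ≤ c

theorem NormLE.zero (x : ℝ) : NormLE x 0 0 := by
  simp [NormLE, summable_zero]

theorem NormLE.one (x : ℝ) : NormLE x 1 1 := by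
  have h : HasSum (fun n : ℤ => |(((1 : LaurentSeries ℤ).coeff n : ℤ) : ℝ)| * x ^ n) 1 := by
    have := hasSum_single (f := fun n : ℤ => |(((1 : LaurentSeries ℤ).coeff n : ℤ) : ℝ)| * x ^ n) 0
      (by intro n hn; simp [HahnSeries.coeff_one, hn])
    simpa [HahnSeries.coeff_one] using this
  exact ⟨h.summable, h.tsum_eq.le⟩

theorem NormLE.neg {x c : ℝ} {f : LaurentSeries ℤ} (h : NormLE x c f) : NormLE x c (-f) := by
  simpa [NormLE] using h

theorem NormLE.mono {x c d : ℝ} {f : LaurentSeries ℤ} (h : NormLE x c f) (hcd : c ≤ d) :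
    NormLE x d f := ⟨h.1, h.2.trans hcd⟩

theorem NormLE.add {x c d : ℝ} (hx : 0 < x) {f g : LaurentSeries ℤ} (hf : NormLE x c f)
    (hg : NormLE x d g) : NormLE x (c + d) (f + g) := by
  have hle : ∀ n : ℤ, |(((f + g).coeff n : ℤ) : ℝ)| * x ^ n ≤
      |(f.coeff n : ℝ)| * x ^ n + |(g.coeff n : ℝ)| * x ^ n := by
    intro n
    rw [← add_mul, HahnSeries.coeff_add, Int.cast_add]
    have := zpow_pos hx n
    gcongr
    exact abs_add_le _ _
  have hs := Summable.of_nonneg_of_le (fun n => by positivity) hle (hf.1.add hg.1)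
  refine ⟨hs, (hs.tsum_le_tsum hle (hf.1.add hg.1)).trans ?_⟩
  rw [hf.1.tsum_add hg.1]
  exact add_le_add hf.2 hg.2

/-- The `n`-th coefficient of a product of Laurent series as a sum over all integers. -/
theorem hasSum_coeff_mul (f g : LaurentSeries ℤ) (n : ℤ) :
    HasSum (fun i : ℤ => (f.coeff i : ℝ) * (g.coeff (n - i) : ℝ)) (((f * g).coeff n : ℤ) : ℝ) := by
  classical
  rw [HahnSeries.coeff_mul]
  set A := Finset.antidiagonal f.isPWO_support g.isPWO_support n with hA
  have hinj : Set.InjOn Prod.fst (A : Set (ℤ × ℤ)) := by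
    rintro ⟨i, j⟩ h ⟨i', j'⟩ h' hii
    simp only [hA, Finset.mem_coe, Finset.mem_antidiagonal, HahnSeries.mem_support] at h h' hii
    ext <;> simp <;> omega
  have h1 : ((∑ ij ∈ A, f.coeff ij.1 * g.coeff ij.2 : ℤ) : ℝ) =
      ∑ i ∈ A.image Prod.fst, (f.coeff i : ℝ) * (g.coeff (n - i) : ℝ) := by
    rw [Finset.sum_image hinj]
    push_cast
    refine Finset.sum_congr rfl fun ij hij => ?_
    simp only [hA, Finset.mem_antidiagonal] at hij
    rw [← hij.2.2, add_sub_cancel_left]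
  rw [h1]
  apply hasSum_sum_of_ne_finset_zero
  intro i hi
  by_contra hne
  apply hi
  have h2 : f.coeff i ≠ 0 ∧ g.coeff (n - i) ≠ 0 := by
    constructor <;> intro h <;> simp [h] at hne
  refine Finset.mem_image.2 ⟨(i, n - i), ?_, rfl⟩
  simp [hA, Finset.mem_antidiagonal, h2]

/-- The shear `(n, i) ↦ (i, n - i)`. -/
def shear : ℤ × ℤ ≃ ℤ × ℤ where
  toFun p := (p.2, p.1 - p.2)
  invFun q := (q.1 + q.2, q.1)
  left_inv p := by simp
  right_inv q := by simp

/-- The series of products, regrouped by total degree. -/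
theorem hasSum_mul {x a b : ℝ} (hx : x ≠ 0) {u v : ℤ → ℝ} (hu : HasSum (fun n => u n * x ^ n) a)
    (hv : HasSum (fun n => v n * x ^ n) b)
    (huv : Summable fun p : ℤ × ℤ => (u p.1 * x ^ p.1) * (v p.2 * x ^ p.2)) :
    HasSum (fun p : ℤ × ℤ => u p.2 * v (p.1 - p.2) * x ^ p.1) (a * b) := by
  have h := (shear.hasSum_iff).2 (hu.mul hv huv)
  refine h.congr_fun ?_
  rintro ⟨n, i⟩
  have : x ^ n = x ^ i * x ^ (n - i) := by rw [← zpow_add₀ hx]; congr 1; ring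
  simp only [Function.comp, shear, Equiv.coe_fn_mk, this]
  ring

theorem NormLE.mul {x c d : ℝ} (hx : 0 < x) {f g : LaurentSeries ℤ} (hf : NormLE x c f)
    (hg : NormLE x d g) : NormLE x (c * d) (f * g) := by
  have hsum := hf.1.mul_of_nonneg hg.1 (fun n => by positivity) (fun n => by positivity)
  have hprod := hasSum_mul hx.ne' hf.1.hasSum hg.1.hasSum hsum
  have hle : ∀ n : ℤ, |(((f * g).coeff n : ℤ) : ℝ)| * x ^ n ≤
      ∑' i : ℤ, |(f.coeff i : ℝ)| * |(g.coeff (n - i) : ℝ)| * x ^ n := by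
    intro n
    have h1 := hprod.summable.prod_factor n
    have hxn : 0 < x ^ n := zpow_pos hx n
    have h2 : Summable fun i : ℤ => |(f.coeff i : ℝ)| * |(g.coeff (n - i) : ℝ)| :=
      (summable_mul_right_iff hxn.ne').1 h1
    rw [tsum_mul_right, ← (hasSum_coeff_mul f g n).tsum_eq]
    gcongr
    have := norm_tsum_le_tsum_norm (f := fun i : ℤ => (f.coeff i : ℝ) * (g.coeff (n - i) : ℝ))
      (by simpa [abs_mul] using h2)
    simpa [abs_mul] using this
  have hs := Summable.of_nonneg_of_le (fun n => by positivity) hle hprod.summable.prod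
  have hbd : ∑' n : ℤ, |(((f * g).coeff n : ℤ) : ℝ)| * x ^ n ≤ _ :=
    hs.tsum_le_tsum hle hprod.summable.prod
  rw [← hprod.summable.tsum_prod, hprod.tsum_eq] at hbd
  unfold NormLE
  refine ⟨hs, hbd.trans ?_⟩
  exact mul_le_mul hf.2 hg.2 (tsum_nonneg fun n => by positivity)
    ((tsum_nonneg fun n => by positivity).trans hf.2)

/-- Evaluation of Laurent series is multiplicative where the series converge absolutely. -/
theorem tsum_coeff_mul {x : ℝ} (hx : 0 < x) {f g : LaurentSeries ℤ}
    (hf : Summable fun n : ℤ => |(f.coeff n : ℝ)| * x ^ n)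
    (hg : Summable fun n : ℤ => |(g.coeff n : ℝ)| * x ^ n) :
    ∑' n : ℤ, (((f * g).coeff n : ℤ) : ℝ) * x ^ n =
      (∑' n : ℤ, (f.coeff n : ℝ) * x ^ n) * ∑' n : ℤ, (g.coeff n : ℝ) * x ^ n := by
  have hn : ∀ n : ℤ, ‖x ^ n‖ = x ^ n := fun n => Real.norm_of_nonneg (zpow_pos hx n).le
  have hf' : Summable fun n : ℤ => ‖(f.coeff n : ℝ) * x ^ n‖ := by
    simpa only [norm_mul, hn, Real.norm_eq_abs] using hf
  have hg' : Summable fun n : ℤ => ‖(g.coeff n : ℝ) * x ^ n‖ := by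
    simpa only [norm_mul, hn, Real.norm_eq_abs] using hg
  have hfs : Summable fun n : ℤ => (f.coeff n : ℝ) * x ^ n := Summable.of_norm hf'
  have hgs : Summable fun n : ℤ => (g.coeff n : ℝ) * x ^ n := Summable.of_norm hg'
  have hfg : Summable fun p : ℤ × ℤ => (f.coeff p.1 : ℝ) * x ^ p.1 * ((g.coeff p.2 : ℝ) * x ^ p.2) :=
    summable_mul_of_summable_norm (f := fun n : ℤ => (f.coeff n : ℝ) * x ^ n)
      (g := fun n : ℤ => (g.coeff n : ℝ) * x ^ n) hf' hg'
  have hprod := hasSum_mul (u := fun n => (f.coeff n : ℝ)) (v := fun n => (g.coeff n : ℝ)) hx.ne'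
    hfs.hasSum hgs.hasSum hfg
  have key : ∀ n : ℤ, ∑' i : ℤ, (f.coeff i : ℝ) * (g.coeff (n - i) : ℝ) * x ^ n =
      (((f * g).coeff n : ℤ) : ℝ) * x ^ n := fun n => by
    rw [tsum_mul_right, (hasSum_coeff_mul f g n).tsum_eq]
  rw [← hprod.tsum_eq, hprod.summable.tsum_prod]
  exact (tsum_congr key).symm

theorem exists_lower_bound {R : Type*} [Zero R] (f : LaurentSeries R) :
    ∃ N : ℤ, ∀ n < N, f.coeff n = 0 :=
  ⟨f.order, fun _ hn => HahnSeries.coeff_eq_zero_of_lt_order hn⟩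

theorem zpow_le_zpow_div {y x : ℝ} (hy : 0 < y) (hyx : y < x) {N n : ℤ} (hn : N ≤ n) :
    y ^ n ≤ (y / x) ^ N * x ^ n := by
  have hx := hy.trans hyx
  have h1 : y ^ n = (y / x) ^ n * x ^ n := by
    rw [← mul_zpow, div_mul_cancel₀ _ hx.ne']
  rw [h1]
  exact mul_le_mul_of_nonneg_right
    (zpow_le_zpow_right_of_le_one₀ (div_pos hy hx) ((div_le_one hx).2 hyx.le) hn) (zpow_pos hx n).le

/-- A Laurent series which converges absolutely at `x` does so at every smaller point. -/
theorem summable_of_lt {y x : ℝ} (hy : 0 < y) (hyx : y < x) {f : LaurentSeries ℤ}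
    (hf : Summable fun n : ℤ => |(f.coeff n : ℝ)| * x ^ n) :
    Summable fun n : ℤ => |(f.coeff n : ℝ)| * y ^ n := by
  obtain ⟨N, hN⟩ := exists_lower_bound f
  have key : ∀ n : ℤ, |(f.coeff n : ℝ)| * y ^ n ≤ (y / x) ^ N * (|(f.coeff n : ℝ)| * x ^ n) := ?_
  · exact Summable.of_nonneg_of_le (fun n => by positivity) key (hf.mul_left ((y / x) ^ N))
  intro n
  rcases lt_or_ge n N with h | h
  · simp [hN n h]
  · calc |(f.coeff n : ℝ)| * y ^ n ≤ |(f.coeff n : ℝ)| * ((y / x) ^ N * x ^ n) := by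
          gcongr; exact zpow_le_zpow_div hy hyx h
      _ = _ := by ring

theorem summable_geometric_int {q : ℝ} (h0 : 0 < q) (h1 : q < 1) (N : ℤ) :
    Summable fun n : ℤ => if n < N then 0 else q ^ n := by
  have hinj : Function.Injective fun k : ℕ => N + (k : ℤ) := by
    intro a b h; simpa using h
  rw [← hinj.summable_iff]
  · have h : ((fun n : ℤ => if n < N then 0 else q ^ n) ∘ fun k : ℕ => N + (k : ℤ)) =
        fun k : ℕ => q ^ N * q ^ k := by
      funext k
      have : ¬ (N + (k : ℤ) < N) := by omega
      simp only [Function.comp, if_neg this, zpow_add₀ h0.ne', zpow_natCast]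
    rw [h]
    exact (summable_geometric_of_lt_one h0.le h1).mul_left _
  · intro n hn
    rw [if_pos]
    by_contra hlt
    exact hn ⟨(n - N).toNat, by simp only; omega⟩

/-! ### The overconvergent ring `ℤ((T))_{>r}` -/

theorem exists_normLE_of_tendsto {r t : ℝ} (hr : 0 < r) (hrt : r < t) {f : LaurentSeries ℤ}
    (h : Tendsto (fun n : ℤ => |(f.coeff n : ℝ)| * t ^ n) atTop (𝓝 0)) :
    ∃ c : ℝ, NormLE r c f := by
  refine ⟨_, ?_, le_rfl⟩
  obtain ⟨N, hN⟩ := exists_lower_bound f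
  have ht := hr.trans hrt
  obtain ⟨M, hM⟩ := eventually_atTop.1 (h.eventually_le_const zero_lt_one)
  have hg := summable_geometric_int (q := r / t) (by positivity) ((div_lt_one ht).2 hrt) N
  refine Summable.of_norm_bounded_eventually hg ?_
  rw [eventually_cofinite]
  refine (Set.finite_Icc N M).subset fun n hn => ?_
  by_contra hnot
  apply hn
  rcases lt_or_ge n N with hlt | hge
  · simp [hN n hlt, hlt]
  · have hMn : M ≤ n := by
      simp only [Set.mem_Icc, not_and, not_le] at hnot
      exact (hnot hge).le
    rw [if_neg (not_lt.2 hge), Real.norm_of_nonneg (by positivity)]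
    have h1 : r ^ n = t ^ n * (r / t) ^ n := by
      rw [← mul_zpow, mul_div_cancel₀ _ ht.ne']
    rw [h1, ← mul_assoc]
    exact mul_le_of_le_one_left (by positivity) (hM n hMn)

theorem tendsto_of_normLE {t c : ℝ} {f : LaurentSeries ℤ} (h : NormLE t c f) :
    Tendsto (fun n : ℤ => |(f.coeff n : ℝ)| * t ^ n) atTop (𝓝 0) :=
  h.1.tendsto_cofinite_zero.mono_left atTop_le_cofinite

theorem exists_normLE_pair {r : ℝ} (hr : 0 < r) {f g : LaurentSeries ℤ}
    (hf : ∃ t > r, Tendsto (fun n : ℤ => |(f.coeff n : ℝ)| * t ^ n) atTop (𝓝 0))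
    (hg : ∃ t > r, Tendsto (fun n : ℤ => |(g.coeff n : ℝ)| * t ^ n) atTop (𝓝 0)) :
    ∃ x > r, ∃ c d : ℝ, NormLE x c f ∧ NormLE x d g := by
  obtain ⟨t, ht, hf⟩ := hf
  obtain ⟨t', ht', hg⟩ := hg
  obtain ⟨x, hx, hx'⟩ := exists_between (lt_min ht ht')
  obtain ⟨c, hc⟩ := exists_normLE_of_tendsto (hr.trans hx) (hx'.trans_le (min_le_left _ _)) hf
  obtain ⟨d, hd⟩ := exists_normLE_of_tendsto (hr.trans hx) (hx'.trans_le (min_le_right _ _)) hg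
  exact ⟨x, hx, c, d, hc, hd⟩

/-- The ring `ℤ((T))_{>r}` of Laurent series `∑ aₙ Tⁿ` over `ℤ` for which there is `t > r` with
`|aₙ| tⁿ → 0` as `n → ∞`. -/
def overconvergent (r : ℝ) (hr : 0 < r) : Subring (LaurentSeries ℤ) where
  carrier := {f | ∃ t > r, Tendsto (fun n : ℤ => |(f.coeff n : ℝ)| * t ^ n) atTop (𝓝 0)}
  mul_mem' := by
    intro f g hf hg
    obtain ⟨x, hx, c, d, hc, hd⟩ := exists_normLE_pair hr hf hg
    exact ⟨x, hx, tendsto_of_normLE (hc.mul (hr.trans hx) hd)⟩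
  one_mem' := ⟨r + 1, by simp, tendsto_of_normLE (NormLE.one _)⟩
  add_mem' := by
    intro f g hf hg
    obtain ⟨x, hx, c, d, hc, hd⟩ := exists_normLE_pair hr hf hg
    exact ⟨x, hx, tendsto_of_normLE (hc.add (hr.trans hx) hd)⟩
  zero_mem' := ⟨r + 1, by simp, tendsto_of_normLE (NormLE.zero _)⟩
  neg_mem' := by
    rintro f ⟨t, ht, h⟩
    exact ⟨t, ht, by simpa using h⟩

/-! ### Sections of `ℤ((T))_r` -/

section Sections

variable {S S' S'' : Type*} [TopologicalSpace S] [TopologicalSpace S'] [TopologicalSpace S'']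

/-- The specialisation `∑ aₙ(s) Tⁿ` of a Laurent series `∑ aₙ Tⁿ` over `C(S, ℤ)` at `s`. -/
def specialize (s : S) (a : LaurentSeries C(S, ℤ)) : LaurentSeries ℤ :=
  a.map (Pi.evalRingHom (fun _ : S => ℤ) s |>.comp ContinuousMap.coeFnRingHom)

@[simp] theorem specialize_coeff (s : S) (a : LaurentSeries C(S, ℤ)) (n : ℤ) :
    (specialize s a).coeff n = a.coeff n s := rfl

/-- The set `ℤ((T))_{r, ≤ c}(S)` of Laurent series `∑ aₙ Tⁿ` over `C(S, ℤ)` such that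
`∑ |aₙ(s)| rⁿ ≤ c` for all `s ∈ S`. -/
def boundedSections (r c : ℝ) (S : Type*) [TopologicalSpace S] : Set (LaurentSeries C(S, ℤ)) :=
  {a | ∀ s : S, Summable (fun n : ℤ => |(a.coeff n s : ℝ)| * r ^ n) ∧
    ∑' n : ℤ, |(a.coeff n s : ℝ)| * r ^ n ≤ c}

theorem mem_boundedSections_iff {r c : ℝ} {a : LaurentSeries C(S, ℤ)} :
    a ∈ boundedSections r c S ↔ ∀ s : S, NormLE r c (specialize s a) := Iff.rfl

theorem specialize_mul (s : S) (a b : LaurentSeries C(S, ℤ)) :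
    specialize s (a * b) = specialize s a * specialize s b :=
  HahnSeries.map_mul (R := C(S, ℤ)) (S := ℤ)
    (((Pi.evalRingHom (fun _ : S => ℤ) s).comp ContinuousMap.coeFnRingHom : C(S, ℤ) →+* ℤ) :
      C(S, ℤ) →ₙ+* ℤ)

theorem specialize_one (s : S) : specialize s (1 : LaurentSeries C(S, ℤ)) = 1 := by
  ext n
  by_cases hn : n = 0 <;> simp [HahnSeries.coeff_one, hn]

theorem specialize_add (s : S) (a b : LaurentSeries C(S, ℤ)) :
    specialize s (a + b) = specialize s a + specialize s b := by
  ext n; simp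

theorem specialize_neg (s : S) (a : LaurentSeries C(S, ℤ)) :
    specialize s (-a) = -specialize s a := by
  ext n; simp

theorem specialize_zero (s : S) : specialize s (0 : LaurentSeries C(S, ℤ)) = 0 := by
  ext n; simp

/-- The ring of sections `ℤ((T))_r(S) = ⋃_{c > 0} ℤ((T))_{r, ≤ c}(S)`. -/
def sections (r : ℝ) (hr : 0 < r) (S : Type*) [TopologicalSpace S] :
    Subring (LaurentSeries C(S, ℤ)) where
  carrier := ⋃ c > (0 : ℝ), boundedSections r c S
  mul_mem' := by
    simp only [Set.mem_iUnion, mem_boundedSections_iff]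
    rintro a b ⟨c, hc, ha⟩ ⟨d, hd, hb⟩
    exact ⟨c * d, mul_pos hc hd, fun s => by
      rw [specialize_mul]; exact (ha s).mul hr (hb s)⟩
  one_mem' := by
    simp only [Set.mem_iUnion, mem_boundedSections_iff]
    exact ⟨1, one_pos, fun s => by rw [specialize_one]; exact NormLE.one r⟩
  add_mem' := by
    simp only [Set.mem_iUnion, mem_boundedSections_iff]
    rintro a b ⟨c, hc, ha⟩ ⟨d, hd, hb⟩
    exact ⟨c + d, add_pos hc hd, fun s => by
      rw [specialize_add]; exact (ha s).add hr (hb s)⟩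
  zero_mem' := by
    simp only [Set.mem_iUnion, mem_boundedSections_iff]
    exact ⟨1, one_pos, fun s => by
      rw [specialize_zero]; exact (NormLE.zero r).mono zero_le_one⟩
  neg_mem' := by
    simp only [Set.mem_iUnion, mem_boundedSections_iff]
    rintro a ⟨c, hc, ha⟩
    exact ⟨c, hc, fun s => by rw [specialize_neg]; exact (ha s).neg⟩

theorem mem_sections_iff {r : ℝ} {hr : 0 < r} {a : LaurentSeries C(S, ℤ)} :
    a ∈ sections r hr S ↔ ∃ c > 0, ∀ s : S, NormLE r c (specialize s a) := by
  change a ∈ (⋃ c > (0 : ℝ), boundedSections r c S) ↔ _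
  simp only [Set.mem_iUnion, mem_boundedSections_iff, exists_prop]

/-- Pullback of continuous functions as a ring homomorphism. -/
def pullback (A : Type*) [TopologicalSpace A] [CommRing A] [IsTopologicalRing A] (g : C(S', S)) :
    C(S, A) →+* C(S', A) where
  toFun a := a.comp g
  map_one' := rfl
  map_mul' _ _ := rfl
  map_zero' := rfl
  map_add' _ _ := rfl

/-- Application of a ring homomorphism to all coefficients of a Laurent series. -/
noncomputable def mapCoeff {A B : Type*} [CommRing A] [CommRing B] (φ : A →+* B) :
    LaurentSeries A →+* LaurentSeries B where
  toFun a := a.map φ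
  map_one' := by
    ext n
    by_cases hn : n = 0 <;> simp [HahnSeries.coeff_one, hn]
  map_mul' a b := HahnSeries.map_mul (φ : A →ₙ+* B)
  map_zero' := by ext; simp
  map_add' a b := by ext; simp

@[simp] theorem mapCoeff_coeff {A B : Type*} [CommRing A] [CommRing B] (φ : A →+* B)
    (a : LaurentSeries A) (n : ℤ) : (mapCoeff φ a).coeff n = φ (a.coeff n) := rfl

/-- The restriction map `ℤ((T))_r(S) → ℤ((T))_r(S')`, `∑ aₙ Tⁿ ↦ ∑ (aₙ ∘ g) Tⁿ`, of a continuous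
map `g : S' → S`. -/
noncomputable def restrict (r : ℝ) (hr : 0 < r) (g : C(S', S)) : sections r hr S →+* sections r hr S' :=
  (mapCoeff (pullback ℤ g)).restrict _ _ fun a ha => by
    rw [mem_sections_iff] at ha ⊢
    obtain ⟨c, hc, h⟩ := ha
    exact ⟨c, hc, fun s => h (g s)⟩

@[simp] theorem restrict_coeff (r : ℝ) (hr : 0 < r) (g : C(S', S)) (a : sections r hr S) (n : ℤ)
    (s : S') : (restrict r hr g a).1.coeff n s = a.1.coeff n (g s) := rfl

/-- A Laurent series in `ℤ((T))_{>r}`, viewed as a section of `ℤ((T))_r` over `S` with constant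
coefficients. -/
noncomputable def constSection (r : ℝ) (hr : 0 < r) (S : Type*) [TopologicalSpace S] :
    overconvergent r hr →+* sections r hr S :=
  (mapCoeff (Int.castRingHom C(S, ℤ))).restrict _ _ fun f hf => by
    obtain ⟨t, ht, h⟩ := hf
    obtain ⟨c, hc⟩ := exists_normLE_of_tendsto hr ht h
    rw [mem_sections_iff]
    refine ⟨max c 1, by positivity, fun s => ?_⟩
    have : specialize s (mapCoeff (Int.castRingHom C(S, ℤ)) f) = f := by
      ext n; simp
    rw [this]
    exact hc.mono (le_max_left _ _)

@[simp] theorem constSection_coeff (r : ℝ) (hr : 0 < r) (f : overconvergent r hr) (n : ℤ)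
    (s : S) : (constSection r hr S f).1.coeff n s = f.1.coeff n := by
  simp [constSection]

theorem sections_ext {r : ℝ} {hr : 0 < r} {a b : sections r hr S}
    (h : ∀ n s, a.1.coeff n s = b.1.coeff n s) : a = b :=
  Subtype.ext (HahnSeries.ext (funext fun n => ContinuousMap.ext (h n)))

theorem summable_section {r' r : ℝ} (hr' : 0 < r') (h : r' < r)
    (a : sections r (hr'.trans h) S) (s : S) :
    Summable fun n : ℤ => |(a.1.coeff n s : ℝ)| * r' ^ n := by
  obtain ⟨c, -, ha⟩ := mem_sections_iff.1 a.2
  exact summable_of_lt (f := specialize s a.1) hr' h (ha s).1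

theorem summable_section' {r' r : ℝ} (hr' : 0 < r') (h : r' < r)
    (a : sections r (hr'.trans h) S) (s : S) :
    Summable fun n : ℤ => (a.1.coeff n s : ℝ) * r' ^ n := by
  refine Summable.of_norm ?_
  simpa only [norm_mul, Real.norm_eq_abs, abs_of_pos (zpow_pos hr' _)] using
    summable_section hr' h a s

theorem continuous_evaluation {r' r : ℝ} (hr' : 0 < r') (h : r' < r)
    (a : sections r (hr'.trans h) S) :
    Continuous fun s : S => ∑' n : ℤ, (a.1.coeff n s : ℝ) * r' ^ n := by
  have hr := hr'.trans h
  obtain ⟨c, hc, ha⟩ := mem_sections_iff.1 a.2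
  obtain ⟨N, hN⟩ := exists_lower_bound a.1
  refine continuous_tsum (fun n => ?_)
    ((summable_geometric_int (q := r' / r) (by positivity) ((div_lt_one hr).2 h) N).mul_left c) ?_
  · have h1 : Continuous fun s : S => (a.1.coeff n s : ℝ) :=
      continuous_of_discreteTopology.comp (a.1.coeff n).continuous
    exact h1.mul continuous_const
  · intro n s
    rcases lt_or_ge n N with hlt | hge
    · simp [hN n hlt, hlt]
    · rw [if_neg (not_lt.2 hge), norm_mul, Real.norm_eq_abs, Real.norm_eq_abs,
        abs_of_pos (zpow_pos hr' n)]
      have h1 : |(a.1.coeff n s : ℝ)| * r ^ n ≤ c :=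
        ((ha s).1.le_tsum n fun m _ => by positivity).trans (ha s).2
      have h2 : r' ^ n = r ^ n * (r' / r) ^ n := by
        rw [← mul_zpow, mul_div_cancel₀ _ hr.ne']
      rw [h2, ← mul_assoc]
      gcongr

/-- The map `θ_{r'} : ℤ((T))_r(S) → C(S, ℝ)`, `∑ aₙ Tⁿ ↦ ∑ aₙ r'ⁿ`, for `0 < r' < r`. -/
noncomputable def evaluation (r' r : ℝ) (hr' : 0 < r') (h : r' < r) (S : Type*)
    [TopologicalSpace S] : sections r (hr'.trans h) S →+* C(S, ℝ) where
  toFun a := ⟨fun s => ∑' n : ℤ, (a.1.coeff n s : ℝ) * r' ^ n, continuous_evaluation hr' h a⟩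
  map_one' := by
    ext s
    have := hasSum_single (f := fun n : ℤ =>
      (((1 : LaurentSeries C(S, ℤ)).coeff n s : ℤ) : ℝ) * r' ^ n) 0
      (by intro n hn; simp [HahnSeries.coeff_one, hn])
    simpa [HahnSeries.coeff_one] using this.tsum_eq
  map_mul' a b := by
    ext s
    have := tsum_coeff_mul (f := specialize s a.1) (g := specialize s b.1) hr'
      (summable_section hr' h a s) (summable_section hr' h b s)
    rw [← specialize_mul] at this
    exact this
  map_zero' := by ext s; simp
  map_add' a b := by
    ext s
    have := (summable_section' hr' h a s).tsum_add (summable_section' hr' h b s)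
    simpa [add_mul] using this

end Sections

/-! ### Condensed rings -/

/-- Condensed commutative rings. -/
abbrev CondensedRing := Condensed.{u} CommRingCat.{u + 1}

/-- A presheaf of rings on compact Hausdorff spaces is a condensed ring as soon as compatible
families on finite jointly surjective families can be glued uniquely. -/
theorem isSheaf_of_glue (F : CompHaus.{u}ᵒᵖ ⥤ CommRingCat.{u + 1})
    (h : ∀ (α : Type) [Finite α] (B : CompHaus.{u}) (X : α → CompHaus.{u})
      (π : (a : α) → (X a ⟶ B)), (∀ b : B, ∃ (a : α) (x : X a), π a x = b) →
      ∀ x : (a : α) → F.obj (op (X a)),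
      (∀ (i j : α) (Z : CompHaus.{u}) (gi : Z ⟶ X i) (gj : Z ⟶ X j), gi ≫ π i = gj ≫ π j →
        F.map gi.op (x i) = F.map gj.op (x j)) →
      ∃! t : F.obj (op B), ∀ a, F.map (π a).op t = x a) :
    Presheaf.IsSheaf (coherentTopology CompHaus.{u}) F := by
  apply Presheaf.isSheaf_coherent_of_hasPullbacks_of_comp F (forget CommRingCat.{u + 1})
  rw [isSheaf_iff_isSheaf_of_type]
  refine (Presieve.isSheaf_coverage (coherentCoverage CompHaus.{u}) _).2 ?_
  rintro B R ⟨α, _, X, π, rfl, hπ⟩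
  rw [Presieve.isSheafFor_arrows_iff]
  intro x hx
  exact h α B X π (((CompHaus.effectiveEpiFamily_tfae X π).out 0 2).1 hπ) x hx

/-- Gluing of continuous functions along finite jointly surjective families. -/
theorem exists_glue {A : Type*} [TopologicalSpace A] {α : Type} [Finite α] {B : CompHaus.{u}}
    {X : α → CompHaus.{u}} {π : (a : α) → (X a ⟶ B)}
    (hπ : ∀ b : B, ∃ (a : α) (x : X a), π a x = b) (f : (a : α) → C(X a, A))
    (hf : ∀ i j (x : X i) (y : X j), π i x = π j y → f i x = f j y) :
    ∃ t : C(B, A), ∀ a x, t (π a x) = f a x := by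
  let p : (Σ a, X a) → B := fun q => π q.1 q.2
  have hpc : Continuous p := continuous_sigma fun a => (π a).hom.hom.continuous
  have hps : Function.Surjective p := fun b => by
    obtain ⟨a, x, h⟩ := hπ b
    exact ⟨⟨a, x⟩, h⟩
  have hq : IsQuotientMap p := IsQuotientMap.of_surjective_continuous hps hpc
  let F : C((Σ a, X a), A) := ⟨fun q => f q.1 q.2, continuous_sigma fun a => (f a).continuous⟩
  refine ⟨hq.lift (f := ⟨p, hpc⟩) F fun q q' h => hf _ _ _ _ h, fun a x => ?_⟩
  exact DFunLike.congr_fun (hq.lift_comp (f := ⟨p, hpc⟩) F fun q q' h => hf _ _ _ _ h) ⟨a, x⟩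

/-- The presheaf `S ↦ ℤ((T))_r(S)` on compact Hausdorff spaces. -/
noncomputable def laurentPresheaf (r : ℝ) (hr : 0 < r) :
    CompHaus.{u}ᵒᵖ ⥤ CommRingCat.{u + 1} where
  obj S := CommRingCat.of (ULift.{u + 1} (sections r hr S.unop))
  map g := CommRingCat.ofHom
    (ULift.ringEquiv.symm.toRingHom.comp
      ((restrict r hr g.unop.hom.hom).comp ULift.ringEquiv.toRingHom))

/-- The presheaf `S ↦ C(S, ℝ)` on compact Hausdorff spaces. -/
noncomputable def realPresheaf : CompHaus.{u}ᵒᵖ ⥤ CommRingCat.{u + 1} where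
  obj S := CommRingCat.of (ULift.{u + 1} C(S.unop, ℝ))
  map g := CommRingCat.ofHom
    (ULift.ringEquiv.symm.toRingHom.comp
      ((pullback ℝ g.unop.hom.hom).comp ULift.ringEquiv.toRingHom))

@[simp] theorem laurentPresheaf_map_coeff (r : ℝ) (hr : 0 < r) {S S' : CompHaus.{u}} (g : S' ⟶ S)
    (a : (laurentPresheaf r hr).obj (op S)) (n : ℤ) (s : S') :
    ((laurentPresheaf r hr).map g.op a).down.1.coeff n s = a.down.1.coeff n (g s) := rfl

@[simp] theorem realPresheaf_map_apply {S S' : CompHaus.{u}} (g : S' ⟶ S)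
    (a : realPresheaf.obj (op S)) (s : S') :
    (realPresheaf.map g.op a).down s = a.down (g s) := rfl

theorem laurent_ext {r : ℝ} {hr : 0 < r} {S : CompHaus.{u}}
    {a b : (laurentPresheaf r hr).obj (op S)}
    (h : ∀ n (s : S), a.down.1.coeff n s = b.down.1.coeff n s) : a = b :=
  ULift.ext _ _ (sections_ext h)

theorem real_ext {S : CompHaus.{u}} {a b : realPresheaf.obj (op S)}
    (h : ∀ s : S, a.down s = b.down s) : a = b :=
  ULift.ext _ _ (ContinuousMap.ext h)

/-- The map from the one-point space with a given value. -/
def pointMap {S : CompHaus.{u}} (s : S) : CompHaus.of PUnit.{u + 1} ⟶ S :=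
  CompHausLike.ofHom _ (ContinuousMap.const _ s)

theorem laurentPresheaf_isSheaf (r : ℝ) (hr : 0 < r) :
    Presheaf.IsSheaf (coherentTopology CompHaus.{u}) (laurentPresheaf.{u} r hr) := by
  apply isSheaf_of_glue
  intro α _ B X π hπ x hx
  have hcomp : ∀ i j (y : X i) (z : X j), π i y = π j z →
      ∀ n, (x i).down.1.coeff n y = (x j).down.1.coeff n z := by
    intro i j y z h n
    have h1 := hx i j (CompHaus.of PUnit.{u + 1}) (pointMap y) (pointMap z)
      (by ext; exact h)
    exact congrArg (fun q : (laurentPresheaf r hr).obj (op (CompHaus.of PUnit.{u + 1})) =>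
      q.down.1.coeff n PUnit.unit) h1
  choose t ht using fun n => exists_glue hπ (fun a => (x a).down.1.coeff n)
    fun i j y z h => hcomp i j y z h n
  choose N hN using fun a => exists_lower_bound (x a).down.1
  obtain ⟨M, hM⟩ := (Set.finite_range N).bddBelow
  have htM : ∀ n < M, t n = 0 := by
    intro n hn
    ext b
    obtain ⟨a, y, rfl⟩ := hπ b
    rw [ht, hN a n (hn.trans_le (hM ⟨a, rfl⟩))]
    rfl
  let T : LaurentSeries C(B, ℤ) := HahnSeries.ofSuppBddBelow t
    ⟨M, fun n hn => by by_contra hlt; exact hn (htM n (not_le.1 hlt))⟩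
  have hT : T ∈ sections r hr B := by
    choose c hc0 hc using fun a => mem_sections_iff.1 (x a).down.2
    obtain ⟨D, hD⟩ := (Set.finite_range c).bddAbove
    refine mem_sections_iff.2 ⟨max D 1, by positivity, fun b => ?_⟩
    obtain ⟨a, y, rfl⟩ := hπ b
    have h1 : specialize (π a y) T = specialize y (x a).down.1 := by
      ext n
      exact ht n a y
    rw [h1]
    exact (hc a y).mono ((hD ⟨a, rfl⟩).trans (le_max_left _ _))
  refine ⟨⟨⟨T, hT⟩⟩, fun a => laurent_ext fun n s => ht n a s, fun t' ht' => ?_⟩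
  refine laurent_ext fun n b => ?_
  obtain ⟨a, y, rfl⟩ := hπ b
  have h1 := congrArg (fun q : (laurentPresheaf r hr).obj (op (X a)) =>
    q.down.1.coeff n y) (ht' a)
  exact h1.trans (ht n a y).symm

theorem realPresheaf_isSheaf :
    Presheaf.IsSheaf (coherentTopology CompHaus.{u}) realPresheaf.{u} := by
  apply isSheaf_of_glue
  intro α _ B X π hπ x hx
  obtain ⟨t, ht⟩ := exists_glue hπ (fun a => (x a).down) fun i j y z h => by
    have h1 := hx i j (CompHaus.of PUnit.{u + 1}) (pointMap y) (pointMap z)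
      (by ext; exact h)
    exact congrArg (fun q : realPresheaf.obj (op (CompHaus.of PUnit.{u + 1})) =>
      q.down PUnit.unit) h1
  refine ⟨⟨t⟩, fun a => real_ext fun s => ht a s, fun t' ht' => ?_⟩
  refine real_ext fun b => ?_
  obtain ⟨a, y, rfl⟩ := hπ b
  have h1 := congrArg (fun q : realPresheaf.obj (op (X a)) => q.down y) (ht' a)
  exact h1.trans (ht a y).symm

/-- The condensed ring `ℤ((T))_r`. -/
noncomputable def laurent (r : ℝ) (hr : 0 < r) : CondensedRing.{u} :=
  ⟨laurentPresheaf r hr, laurentPresheaf_isSheaf r hr⟩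

/-- The condensed ring `ℝ`, with sections `C(S, ℝ)`. -/
noncomputable def real : CondensedRing.{u} := ⟨realPresheaf, realPresheaf_isSheaf⟩

/-- The section of the condensed ring `ℤ((T))_r` over `S` with constant coefficients given by
`f ∈ ℤ((T))_{>r}`. -/
noncomputable def constPoint (r : ℝ) (hr : 0 < r) (f : overconvergent r hr) (S : CompHaus.{u}) :
    (laurent.{u} r hr).obj.obj (op S) :=
  ULift.up (constSection r hr S f)

/-- The map of condensed rings `θ_{r'} : ℤ((T))_r ⟶ ℝ`, `∑ aₙ Tⁿ ↦ ∑ aₙ r'ⁿ`. -/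
noncomputable def theta (r' r : ℝ) (hr' : 0 < r') (h : r' < r) :
    laurent.{u} r (hr'.trans h) ⟶ real.{u} :=
  ⟨{ app := fun S => CommRingCat.ofHom
      (ULift.ringEquiv.symm.toRingHom.comp
        ((evaluation r' r hr' h S.unop).comp ULift.ringEquiv.toRingHom))
     naturality := fun _ _ _ => rfl }⟩

/-! ### Underlying condensed abelian groups -/

/-- The underlying abelian group of a commutative ring (Mathlib's condensed abelian groups are
condensed modules over `ULift ℤ`). -/
def ringToAb : CommRingCat.{u + 1} ⥤ ModuleCat.{u + 1} (ULift.{u + 1} ℤ) where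
  obj R := ModuleCat.of _ R
  map φ := ModuleCat.ofHom
    { toFun := φ
      map_add' := map_add φ.hom
      map_smul' := fun n x => map_zsmul φ.hom n.down x }

/-- The underlying condensed abelian group of a condensed ring. -/
def toAb : CondensedRing.{u} ⥤ CondensedAb.{u} where
  obj R := ⟨R.obj ⋙ ringToAb, by
    apply Presheaf.isSheaf_coherent_of_hasPullbacks_of_comp _
      (forget (ModuleCat.{u + 1} (ULift.{u + 1} ℤ)))
    exact ((sheafCompose _ (forget CommRingCat.{u + 1})).obj R).property⟩
  map φ := ⟨Functor.whiskerRight φ.hom ringToAb⟩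

theorem restrict_constSection {S S' : Type*} [TopologicalSpace S] [TopologicalSpace S'] (r : ℝ)
    (hr : 0 < r) (g : C(S', S)) (f : overconvergent r hr) :
    restrict r hr g (constSection r hr S f) = constSection r hr S' f :=
  sections_ext fun n s => by simp

/-- The endomorphism of the condensed abelian group `ℤ((T))_r` given by multiplication by
`f ∈ ℤ((T))_{>r}`. -/
noncomputable def mulConst (r : ℝ) (hr : 0 < r) (f : overconvergent r hr) :
    toAb.obj (laurent.{u} r hr) ⟶ toAb.obj (laurent.{u} r hr) :=
  ⟨{ app := fun S => ModuleCat.ofHom (LinearMap.mulLeft (ULift.{u + 1} ℤ)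
        (show ULift.{u + 1} (sections r hr S.unop) from constPoint r hr f S.unop))
     naturality := fun S S' g => by
      ext x
      change ULift.up (constSection r hr S'.unop f * restrict r hr g.unop.hom.hom x.down) =
        ULift.up (restrict r hr g.unop.hom.hom (constSection r hr S.unop f * x.down))
      rw [map_mul, restrict_constSection] }⟩

end CondensedLaurent

/-!
Surjectivity of `θ_{r'}` is expansion in base `r'`. On a profinite space every continuous real
function is within distance `1` of a continuous integer-valued one
(`exists_continuous_int_near`), so rounding, dividing the remainder by `r'` and repeating writes
`g ∈ C(S, ℝ)` as `∑ cₙ r'ⁿ` with uniformly bounded `cₙ ∈ C(S, ℤ)`; as `r < 1`, the series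
`∑ cₙ Tⁿ` lies in `ℤ((T))_r(S)` (`evaluation_surjective`).

The generator of the kernel is an integral power series
`f = (1 - T / r') ∏ (1 + εₙ Tⁿ⁺¹)` with `|εₙ| ≤ 1 / 2`. The `εₙ` are chosen one after the other: the
`n`-th factor changes the coefficient of `Tⁿ⁺¹` by exactly `εₙ` and no earlier one, so that it can
be used to round this coefficient to an integer (`exists_integral_partial_products`). The product
`L = ∏ (1 + εₙ Tⁿ⁺¹)` and its inverse have finite weighted norm `∑ |aₙ| tⁿ` for every `t < 1`, since
each factor and its inverse have norm at most `1 + tⁿ⁺¹` (`exists_integral_multiple`). In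
particular `f` is overconvergent and vanishes at `r'`.

The constant coefficient of `f` is `1`, so `f` is invertible in `ℤ⟦T⟧`. Hence multiplication by
`f` is injective on Laurent series over `C(S, ℤ)`, and every such series `a` is `f · (a f⁻¹)`.
If `a` lies in the kernel of `θ_{r'}`, then at each point `a = (1 - T / r') b`, where the
coefficients `-∑_{k > n} aₖ r'^(k - n)` of `b` show that the norm of `b` at radius `r` is at
most a constant times that of `a` (`exists_mul_linear_eq`). Since `a f⁻¹ = b L⁻¹`, the quotient
lies in `ℤ((T))_r(S)`, with a bound uniform in the point (`exists_normLE_quotient`).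

The statements about condensed abelian groups follow: epimorphisms are tested on extremally
disconnected spaces, and a sequence that is left exact on all sections is left exact
(`exact_of_ker_le_range`).
-/

namespace CondensedLaurent

open Filter Topology

open scoped ENNReal

/-! ### Weighted norms of real Laurent series -/

/-- The weighted `ℓ¹`-norm `∑ |aₙ| tⁿ ∈ [0, ∞]` of a real Laurent series `∑ aₙ Tⁿ`. -/
noncomputable def wnorm (t : ℝ) (f : LaurentSeries ℝ) : ℝ≥0∞ :=
  ∑' n : ℤ, ENNReal.ofReal (|f.coeff n| * t ^ n)

theorem wnorm_add_le {t : ℝ} (ht : 0 < t) (f g : LaurentSeries ℝ) :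
    wnorm t (f + g) ≤ wnorm t f + wnorm t g := by
  rw [wnorm, wnorm, wnorm, ← ENNReal.tsum_add]
  refine ENNReal.tsum_le_tsum fun n => ?_
  have := zpow_pos ht n
  rw [← ENNReal.ofReal_add (by positivity) (by positivity), ← add_mul, HahnSeries.coeff_add]
  gcongr
  exact abs_add_le _ _

theorem wnorm_single (t : ℝ) (n : ℤ) (x : ℝ) :
    wnorm t (HahnSeries.single n x) = ENNReal.ofReal (|x| * t ^ n) := by
  rw [wnorm, tsum_eq_single n]
  · simp
  · intro m hm
    simp [HahnSeries.coeff_single_of_ne hm]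

theorem wnorm_one (t : ℝ) : wnorm t 1 = 1 := by
  simpa using wnorm_single t 0 1

theorem wnorm_mul_le {t : ℝ} (ht : 0 < t) (f g : LaurentSeries ℝ) :
    wnorm t (f * g) ≤ wnorm t f * wnorm t g := by
  have hcoeff : ∀ n : ℤ, ENNReal.ofReal (|(f * g).coeff n| * t ^ n) ≤
      ∑' i : ℤ, ENNReal.ofReal (|f.coeff i| * t ^ i) *
        ENNReal.ofReal (|g.coeff (n - i)| * t ^ (n - i)) := by
    intro n
    rw [HahnSeries.coeff_mul]
    set A := Finset.antidiagonal f.isPWO_support g.isPWO_support n with hA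
    have hmem : ∀ p ∈ A, p.2 = n - p.1 := fun p hp => by
      have := (Finset.mem_antidiagonal.1 hp).2.2
      omega
    have hinj : Set.InjOn Prod.fst (A : Set (ℤ × ℤ)) := fun p hp q hq hpq =>
      Prod.ext hpq (by rw [hmem p hp, hmem q hq, hpq])
    calc ENNReal.ofReal (|∑ p ∈ A, f.coeff p.1 * g.coeff p.2| * t ^ n)
        ≤ ENNReal.ofReal (∑ p ∈ A, |f.coeff p.1 * g.coeff p.2| * t ^ n) := by
          rw [← Finset.sum_mul]
          gcongr
          exact Finset.abs_sum_le_sum_abs _ _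
      _ = ∑ p ∈ A, ENNReal.ofReal (|f.coeff p.1 * g.coeff p.2| * t ^ n) :=
          ENNReal.ofReal_sum_of_nonneg fun p _ => by positivity
      _ = ∑ p ∈ A, ENNReal.ofReal (|f.coeff p.1| * t ^ p.1) *
            ENNReal.ofReal (|g.coeff (n - p.1)| * t ^ (n - p.1)) := by
          refine Finset.sum_congr rfl fun p hp => ?_
          rw [← ENNReal.ofReal_mul (by positivity), hmem p hp, abs_mul,
            show t ^ n = t ^ p.1 * t ^ (n - p.1) by rw [← zpow_add₀ ht.ne']; congr 1; ring]
          congr 1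
          ring
      _ = ∑ i ∈ A.image Prod.fst, ENNReal.ofReal (|f.coeff i| * t ^ i) *
            ENNReal.ofReal (|g.coeff (n - i)| * t ^ (n - i)) := by
          rw [Finset.sum_image hinj]
      _ ≤ _ := ENNReal.sum_le_tsum _
  calc wnorm t (f * g)
      ≤ ∑' n : ℤ, ∑' i : ℤ, ENNReal.ofReal (|f.coeff i| * t ^ i) *
          ENNReal.ofReal (|g.coeff (n - i)| * t ^ (n - i)) := ENNReal.tsum_le_tsum hcoeff
    _ = ∑' i : ℤ, ENNReal.ofReal (|f.coeff i| * t ^ i) * wnorm t g := by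
        rw [ENNReal.tsum_comm]
        refine tsum_congr fun i => ?_
        rw [ENNReal.tsum_mul_left, wnorm]
        congr 1
        exact (Equiv.subRight i).tsum_eq fun m => ENNReal.ofReal (|g.coeff m| * t ^ m)
    _ = wnorm t f * wnorm t g := ENNReal.tsum_mul_right

/-- Bounds on the weighted norm pass to coefficientwise eventually constant limits. -/
theorem wnorm_le_of_eventually_eq {t : ℝ} {p : ℕ → LaurentSeries ℝ} {f : LaurentSeries ℝ}
    {C : ℝ≥0∞} (hp : ∀ N, wnorm t (p N) ≤ C)
    (h : ∀ n : ℤ, ∀ᶠ N in atTop, (p N).coeff n = f.coeff n) : wnorm t f ≤ C := by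
  rw [wnorm, ENNReal.tsum_eq_iSup_sum]
  refine iSup_le fun s => ?_
  obtain ⟨N, hN⟩ := ((Filter.eventually_all_finset s).2 fun n _ => h n).exists
  calc ∑ n ∈ s, ENNReal.ofReal (|f.coeff n| * t ^ n)
      = ∑ n ∈ s, ENNReal.ofReal (|(p N).coeff n| * t ^ n) :=
        Finset.sum_congr rfl fun n hn => by rw [hN n hn]
    _ ≤ wnorm t (p N) := ENNReal.sum_le_tsum _
    _ ≤ C := hp N

theorem summable_of_wnorm_ne_top {t : ℝ} (ht : 0 < t) {f : LaurentSeries ℝ}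
    (h : wnorm t f ≠ ∞) : Summable fun n : ℤ => |f.coeff n| * t ^ n := by
  refine (ENNReal.summable_toReal h).congr fun n => ?_
  exact ENNReal.toReal_ofReal (by positivity)

theorem normLE_iff_wnorm_le {t c : ℝ} (ht : 0 < t) (hc : 0 ≤ c) (f : LaurentSeries ℤ) :
    NormLE t c f ↔ wnorm t (mapCoeff (Int.castRingHom ℝ) f) ≤ ENNReal.ofReal c := by
  have hpos : ∀ n : ℤ, 0 ≤ |(f.coeff n : ℝ)| * t ^ n := fun n => by positivity
  have hcoeff : ∀ n : ℤ, (mapCoeff (Int.castRingHom ℝ) f).coeff n = (f.coeff n : ℝ) := fun n => by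
    rw [mapCoeff_coeff, eq_intCast]
  constructor
  · rintro ⟨hs, hle⟩
    simp only [wnorm, hcoeff]
    rw [← ENNReal.ofReal_tsum_of_nonneg hpos hs]
    exact ENNReal.ofReal_le_ofReal hle
  · intro h
    have hs := summable_of_wnorm_ne_top ht (ne_top_of_le_ne_top ENNReal.ofReal_ne_top h)
    simp only [wnorm, hcoeff] at h hs
    rw [← ENNReal.ofReal_tsum_of_nonneg hpos hs] at h
    exact ⟨hs, (ENNReal.ofReal_le_ofReal_iff hc).1 h⟩

/-! ### Infinite products -/

/-- An infinite product `∏ uₙ` of power series with `uₙ ≡ 1` modulo `X ^ (n + 1)` converges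
coefficientwise. -/
theorem exists_prod_congr {R : Type*} [CommRing R] (u : ℕ → PowerSeries R)
    (hu : ∀ n, (PowerSeries.X : PowerSeries R) ^ (n + 1) ∣ u n - 1) :
    ∃ L : PowerSeries R, ∀ N, PowerSeries.X ^ (N + 1) ∣ L - ∏ n ∈ Finset.range N, u n := by
  have hstep : ∀ k N, k ≤ N → PowerSeries.coeff k (∏ n ∈ Finset.range N, u n) =
      PowerSeries.coeff k (∏ n ∈ Finset.range k, u n) := by
    intro k N hkN
    induction N, hkN using Nat.le_induction with
    | base => rfl
    | succ N hkN ih =>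
      rw [← ih, ← sub_eq_zero, ← map_sub, Finset.prod_range_succ,
        show ∀ a b : PowerSeries R, a * b - a = a * (b - 1) by intros; ring]
      exact PowerSeries.X_pow_dvd_iff.1 (Dvd.dvd.mul_left (hu N) _) k (by omega)
  refine ⟨PowerSeries.mk fun k => PowerSeries.coeff k (∏ n ∈ Finset.range k, u n), fun N => ?_⟩
  rw [PowerSeries.X_pow_dvd_iff]
  intro k hk
  rw [map_sub, PowerSeries.coeff_mk, hstep k N (by omega), sub_self]

theorem eventually_coeff_eq {p : ℕ → PowerSeries ℝ} {L : PowerSeries ℝ}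
    (h : ∀ N, (PowerSeries.X : PowerSeries ℝ) ^ (N + 1) ∣ L - p N) (n : ℤ) :
    ∀ᶠ N in atTop, (HahnSeries.ofPowerSeries ℤ ℝ (p N)).coeff n =
      (HahnSeries.ofPowerSeries ℤ ℝ L).coeff n := by
  filter_upwards [eventually_ge_atTop n.natAbs] with N hN
  rw [PowerSeries.coeff_coe, PowerSeries.coeff_coe]
  have := PowerSeries.X_pow_dvd_iff.1 (h N) n.natAbs (Nat.lt_succ_of_le hN)
  rw [map_sub, sub_eq_zero] at this
  rw [this]

/-- An infinite product whose factors have norm at most `1 + t ^ (n + 1)` has norm at most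
`exp (∑ t ^ (n + 1))`. -/
theorem wnorm_prod_lt_top {t : ℝ} (ht0 : 0 < t) (ht1 : t < 1) {u : ℕ → PowerSeries ℝ}
    (hu : ∀ n, wnorm t (HahnSeries.ofPowerSeries ℤ ℝ (u n)) ≤ ENNReal.ofReal (1 + t ^ (n + 1)))
    {L : PowerSeries ℝ}
    (hL : ∀ N, (PowerSeries.X : PowerSeries ℝ) ^ (N + 1) ∣ L - ∏ n ∈ Finset.range N, u n) :
    wnorm t (HahnSeries.ofPowerSeries ℤ ℝ L) < ∞ := by
  have hs : Summable fun n : ℕ => t ^ (n + 1) :=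
    (summable_nat_add_iff 1).2 (summable_geometric_of_lt_one ht0.le ht1)
  have hfin : ∀ N, wnorm t (HahnSeries.ofPowerSeries ℤ ℝ (∏ n ∈ Finset.range N, u n)) ≤
      ENNReal.ofReal (∏ n ∈ Finset.range N, (1 + t ^ (n + 1))) := by
    intro N
    induction N with
    | zero => simp [wnorm_one]
    | succ N ih =>
      rw [Finset.prod_range_succ, Finset.prod_range_succ, map_mul,
        ENNReal.ofReal_mul (Finset.prod_nonneg fun n _ => by positivity)]
      exact (wnorm_mul_le ht0 _ _).trans (mul_le_mul' ih (hu N))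
  refine (wnorm_le_of_eventually_eq (C := ENNReal.ofReal (Real.exp (∑' n : ℕ, t ^ (n + 1))))
    (fun N => (hfin N).trans (ENNReal.ofReal_le_ofReal ?_))
    (eventually_coeff_eq hL)).trans_lt ENNReal.ofReal_lt_top
  refine (Real.prod_one_add_le_exp_sum _ fun n => by positivity).trans ?_
  exact Real.exp_le_exp.2 (hs.sum_le_tsum _ fun n _ => by positivity)

theorem ofPowerSeries_C_mul_X_pow (m : ℕ) (x : ℝ) :
    HahnSeries.ofPowerSeries ℤ ℝ (PowerSeries.C x * PowerSeries.X ^ m) =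
      HahnSeries.single (m : ℤ) x := by
  rw [map_mul, HahnSeries.ofPowerSeries_C, HahnSeries.ofPowerSeries_X_pow,
    HahnSeries.C_apply, HahnSeries.single_mul_single]
  simp

theorem wnorm_one_add_monomial_le {t : ℝ} (ht : 0 < t) {x : ℝ} (hx : |x| ≤ 1 / 2) (m : ℕ) :
    wnorm t (HahnSeries.ofPowerSeries ℤ ℝ (1 + PowerSeries.C x * PowerSeries.X ^ m)) ≤
      ENNReal.ofReal (1 + t ^ m) := by
  rw [map_add, map_one, ofPowerSeries_C_mul_X_pow]
  refine (wnorm_add_le ht _ _).trans ?_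
  rw [wnorm_one, wnorm_single, ENNReal.ofReal_add zero_le_one (by positivity), ENNReal.ofReal_one,
    zpow_natCast]
  gcongr
  exact mul_le_of_le_one_left (by positivity) (by linarith)

theorem constantCoeff_one_add_monomial (x : ℝ) (m : ℕ) :
    PowerSeries.constantCoeff (1 + PowerSeries.C x * PowerSeries.X ^ (m + 1)) = 1 := by
  simp

/-- The inverse of `1 + x X ^ (m + 1)` is a geometric series, of norm at most
`(1 - t ^ (m + 1) / 2)⁻¹ ≤ 1 + t ^ (m + 1)`. -/
theorem wnorm_one_add_monomial_inv_le {t : ℝ} (ht0 : 0 < t) (ht1 : t < 1) {x : ℝ}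
    (hx : |x| ≤ 1 / 2) (m : ℕ) :
    wnorm t (HahnSeries.ofPowerSeries ℤ ℝ
      (1 + PowerSeries.C x * PowerSeries.X ^ (m + 1))⁻¹) ≤ ENNReal.ofReal (1 + t ^ (m + 1)) := by
  set v : PowerSeries ℝ := PowerSeries.C x * PowerSeries.X ^ (m + 1) with hv
  have hinv : (1 + v) * (1 + v)⁻¹ = 1 :=
    PowerSeries.mul_inv_cancel _ (by rw [constantCoeff_one_add_monomial]; exact one_ne_zero)
  -- the partial sums `∑_{j ≤ N} (-v) ^ j`, in Horner form
  let p : ℕ → PowerSeries ℝ := fun N => Nat.rec 1 (fun _ q => 1 - v * q) N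
  have hp : ∀ N, p (N + 1) = 1 - v * p N := fun N => rfl
  refine wnorm_le_of_eventually_eq (p := fun N => HahnSeries.ofPowerSeries ℤ ℝ (p N)) ?_
    (eventually_coeff_eq ?_)
  · intro N
    have ht : t ^ (m + 1) ≤ 1 := pow_le_one₀ ht0.le ht1.le
    have htp : 0 < t ^ (m + 1) := by positivity
    induction N with
    | zero =>
      change wnorm t (HahnSeries.ofPowerSeries ℤ ℝ 1) ≤ _
      rw [map_one, wnorm_one, ← ENNReal.ofReal_one]
      exact ENNReal.ofReal_le_ofReal (by linarith)
    | succ N ih =>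
      have hcoe : HahnSeries.ofPowerSeries ℤ ℝ (p (N + 1)) =
          1 + HahnSeries.single ((m + 1 : ℕ) : ℤ) (-x) * HahnSeries.ofPowerSeries ℤ ℝ (p N) := by
        rw [← ofPowerSeries_C_mul_X_pow, ← map_mul, ← map_one (HahnSeries.ofPowerSeries ℤ ℝ),
          ← map_add, hp, map_neg, neg_mul, neg_mul, sub_eq_add_neg]
      rw [hcoe]
      refine (wnorm_add_le ht0 _ _).trans ?_
      refine (add_le_add le_rfl ((wnorm_mul_le ht0 _ _).trans (mul_le_mul' le_rfl ih))).trans ?_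
      rw [wnorm_one, wnorm_single, abs_neg, zpow_natCast, ← ENNReal.ofReal_mul (by positivity),
        ← ENNReal.ofReal_one, ← ENNReal.ofReal_add zero_le_one (by positivity)]
      refine ENNReal.ofReal_le_ofReal ?_
      have h1 : |x| * t ^ (m + 1) ≤ 1 / 2 * t ^ (m + 1) := by gcongr
      nlinarith
  · intro N
    have hXv : PowerSeries.X ∣ v :=
      Dvd.dvd.mul_left (dvd_pow_self _ (Nat.succ_ne_zero m)) _
    induction N with
    | zero =>
      have : (1 + v)⁻¹ - p 0 = v * -(1 + v)⁻¹ := by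
        change (1 + v)⁻¹ - 1 = _
        linear_combination hinv
      rw [this, zero_add, pow_one]
      exact hXv.mul_right _
    | succ N ih =>
      have : (1 + v)⁻¹ - p (N + 1) = v * -((1 + v)⁻¹ - p N) := by
        rw [hp]
        linear_combination hinv
      rw [this, pow_succ']
      exact mul_dvd_mul hXv (ih.neg_right)

/-! ### Integral multiples of real power series -/

/-- A real power series with constant coefficient `1` acquires integral coefficients after
multiplication by suitable factors `1 + εₙ X ^ (n + 1)`: the `n`-th factor leaves the coefficients
up to `n` unchanged and adds `εₙ` to the next one. -/
theorem exists_integral_partial_products (p : PowerSeries ℝ)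
    (hp : PowerSeries.constantCoeff p = 1) :
    ∃ ε : ℕ → ℝ, (∀ n, |ε n| ≤ 1 / 2) ∧ ∀ N, ∀ k ≤ N, ∃ m : ℤ, PowerSeries.coeff k
      (p * ∏ n ∈ Finset.range N, (1 + PowerSeries.C (ε n) * PowerSeries.X ^ (n + 1))) =
        (m : ℝ) := by
  let δ : ℕ → PowerSeries ℝ → ℝ := fun n H =>
    round (PowerSeries.coeff (n + 1) (p * H)) - PowerSeries.coeff (n + 1) (p * H)
  -- the partial products, each determining the rounding error `δ` that its next factor corrects
  let H : ℕ → PowerSeries ℝ := fun N =>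
    Nat.rec 1 (fun n q => q * (1 + PowerSeries.C (δ n q) * PowerSeries.X ^ (n + 1))) N
  have hH : ∀ N, H (N + 1) =
      H N * (1 + PowerSeries.C (δ N (H N)) * PowerSeries.X ^ (N + 1)) := fun N => rfl
  have hprod : ∀ N, ∏ n ∈ Finset.range N,
      (1 + PowerSeries.C (δ n (H n)) * PowerSeries.X ^ (n + 1)) = H N := by
    intro N
    induction N with
    | zero => rfl
    | succ N ih => rw [Finset.prod_range_succ, ih, hH]
  have hconst : ∀ N, PowerSeries.constantCoeff (p * H N) = 1 := by
    intro N
    rw [map_mul, hp, one_mul, ← hprod, map_prod]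
    exact Finset.prod_eq_one fun n _ => constantCoeff_one_add_monomial _ _
  refine ⟨fun n => δ n (H n), fun n => ?_, fun N => ?_⟩
  · rw [abs_sub_comm]
    exact abs_sub_round _
  · rw [hprod]
    induction N with
    | zero =>
      intro k hk
      obtain rfl : k = 0 := by omega
      exact ⟨1, by
        rw [PowerSeries.coeff_zero_eq_constantCoeff_apply, Int.cast_one]
        exact hconst 0⟩
    | succ N ih =>
      intro k hk
      have hexp : p * H (N + 1) =
          p * H N + PowerSeries.C (δ N (H N)) * (p * H N) * PowerSeries.X ^ (N + 1) := by
        rw [hH]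
        ring
      rw [hexp, map_add, PowerSeries.coeff_mul_X_pow']
      rcases Nat.lt_or_ge N k with hlt | hge
      · obtain rfl : k = N + 1 := by omega
        refine ⟨round (PowerSeries.coeff (N + 1) (p * H N)), ?_⟩
        rw [if_pos le_rfl, Nat.sub_self, PowerSeries.coeff_zero_eq_constantCoeff_apply,
          map_mul PowerSeries.constantCoeff, hconst, PowerSeries.constantCoeff_C]
        simp only [δ]
        ring
      · rw [if_neg (by omega), add_zero]
        exact ih k hge

/-- A real power series `p` with constant coefficient `1` divides an integral power series `F` with
constant coefficient `1`, in such a way that the quotient and its inverse both have finite norm for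
every radius below `1`. -/
theorem exists_integral_multiple (p : PowerSeries ℝ) (hp : PowerSeries.constantCoeff p = 1) :
    ∃ (F : PowerSeries ℤ) (L L' : PowerSeries ℝ), PowerSeries.constantCoeff F = 1 ∧ L * L' = 1 ∧
      F.map (Int.castRingHom ℝ) = p * L ∧ ∀ t : ℝ, 0 < t → t < 1 →
        wnorm t (HahnSeries.ofPowerSeries ℤ ℝ L) < ∞ ∧
        wnorm t (HahnSeries.ofPowerSeries ℤ ℝ L') < ∞ := by
  obtain ⟨ε, hε, hint⟩ := exists_integral_partial_products p hp
  let u : ℕ → PowerSeries ℝ := fun n => 1 + PowerSeries.C (ε n) * PowerSeries.X ^ (n + 1)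
  have hu : ∀ n, PowerSeries.X ^ (n + 1) ∣ u n - 1 := fun n => ⟨PowerSeries.C (ε n), by
    simp only [u]
    ring⟩
  have hinv : ∀ n, u n * (u n)⁻¹ = 1 := fun n =>
    PowerSeries.mul_inv_cancel _ (by
      simp only [u]
      rw [constantCoeff_one_add_monomial]
      exact one_ne_zero)
  have hu' : ∀ n, PowerSeries.X ^ (n + 1) ∣ (u n)⁻¹ - 1 := fun n => by
    have : (u n)⁻¹ - 1 = (u n - 1) * -(u n)⁻¹ := by linear_combination hinv n
    rw [this]
    exact (hu n).mul_right _
  obtain ⟨L, hL⟩ := exists_prod_congr u hu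
  obtain ⟨L', hL'⟩ := exists_prod_congr (fun n => (u n)⁻¹) hu'
  have hLL : L * L' = 1 := by
    ext k
    rw [← sub_eq_zero, ← map_sub]
    refine PowerSeries.X_pow_dvd_iff.1 ?_ k k.lt_succ_self
    have hprod : (∏ n ∈ Finset.range k, u n) * ∏ n ∈ Finset.range k, (u n)⁻¹ = 1 := by
      rw [← Finset.prod_mul_distrib]
      exact Finset.prod_eq_one fun n _ => hinv n
    have : L * L' - 1 = (L - ∏ n ∈ Finset.range k, u n) * L' +
        (∏ n ∈ Finset.range k, u n) * (L' - ∏ n ∈ Finset.range k, (u n)⁻¹) := by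
      linear_combination hprod
    rw [this]
    exact dvd_add ((hL k).mul_right _) ((hL' k).mul_left _)
  have hcoeff : ∀ k, ∃ m : ℤ, PowerSeries.coeff k (p * L) = (m : ℝ) := fun k => by
    obtain ⟨m, hm⟩ := hint k k le_rfl
    refine ⟨m, ?_⟩
    rw [← hm, ← sub_eq_zero, ← map_sub, ← mul_sub]
    exact PowerSeries.X_pow_dvd_iff.1 ((hL k).mul_left p) k k.lt_succ_self
  choose m hm using hcoeff
  have hF : (PowerSeries.mk m).map (Int.castRingHom ℝ) = p * L := by
    ext k
    rw [PowerSeries.coeff_map, PowerSeries.coeff_mk, hm, eq_intCast]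
  refine ⟨PowerSeries.mk m, L, L', ?_, hLL, hF, fun t ht0 ht1 => ⟨?_, ?_⟩⟩
  · have hL0 : PowerSeries.constantCoeff L = 1 := by
      have h0 := PowerSeries.X_pow_dvd_iff.1 (hL 0) 0 zero_lt_one
      simpa [sub_eq_zero] using h0
    have h0 := hm 0
    rw [PowerSeries.coeff_zero_eq_constantCoeff_apply, map_mul, hp, hL0, one_mul] at h0
    rw [← PowerSeries.coeff_zero_eq_constantCoeff_apply, PowerSeries.coeff_mk]
    exact_mod_cast h0.symm
  · exact wnorm_prod_lt_top ht0 ht1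
      (fun n => wnorm_one_add_monomial_le ht0 (hε n) (n + 1)) hL
  · exact wnorm_prod_lt_top ht0 ht1
      (fun n => wnorm_one_add_monomial_inv_le ht0 ht1 (hε n) n) hL'

/-! ### Division by the linear factor -/

theorem coeff_mul_linear (f : LaurentSeries ℝ) (x : ℝ) (n : ℤ) :
    (f * (1 - HahnSeries.single 1 x)).coeff n = f.coeff n - f.coeff (n - 1) * x := by
  rw [mul_sub, mul_one, HahnSeries.coeff_sub, HahnSeries.coeff_mul_single]

theorem tsum_sub_shift_eq_zero {c : ℤ → ℝ} (hs : Summable c) :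
    ∑' n : ℤ, (c n - c (n - 1)) = 0 := by
  have hs' : Summable fun n : ℤ => c (n - 1) := (Equiv.subRight (1 : ℤ)).summable_iff.2 hs
  have hshift : ∑' n : ℤ, c (n - 1) = ∑' n : ℤ, c n := (Equiv.subRight (1 : ℤ)).tsum_eq c
  rw [hs.tsum_sub hs', hshift, sub_self]

/-- The series `f · (1 - T / y)` vanishes at `T = y`. -/
theorem tsum_coeff_mul_linear {y : ℝ} (hy : 0 < y) (f : LaurentSeries ℝ)
    (hf : wnorm y f ≠ ∞) :
    ∑' n : ℤ, (f * (1 - HahnSeries.single 1 y⁻¹)).coeff n * y ^ n = 0 := by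
  have hterm : ∀ n : ℤ, (f * (1 - HahnSeries.single 1 y⁻¹)).coeff n * y ^ n =
      f.coeff n * y ^ n - f.coeff (n - 1) * y ^ (n - 1) := fun n => by
    rw [coeff_mul_linear, zpow_sub_one₀ hy.ne']
    ring
  have hs : Summable fun n : ℤ => f.coeff n * y ^ n := by
    refine Summable.of_norm ((summable_of_wnorm_ne_top hy hf).congr fun n => ?_)
    rw [norm_mul, Real.norm_eq_abs, Real.norm_of_nonneg (zpow_pos hy n).le]
  exact (tsum_congr hterm).trans (tsum_sub_shift_eq_zero hs)

/-- A series vanishing at `T = y` is divisible by `1 - T / y`, the quotient having coefficients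
`-∑_{k > n} aₖ y ^ (k - n)`; this is bounded in the weighted norm of every radius `x > y`. -/
theorem exists_mul_linear_eq {y x : ℝ} (hy : 0 < y) (hyx : y < x) (a : LaurentSeries ℝ)
    (ha : wnorm x a ≠ ∞) (h0 : ∑' n : ℤ, a.coeff n * y ^ n = 0) :
    ∃ b : LaurentSeries ℝ, b * (1 - HahnSeries.single 1 y⁻¹) = a ∧
      wnorm x b ≤ (∑' j : ℕ, ENNReal.ofReal ((y / x) ^ (j + 1))) * wnorm x a := by
  have hx := hy.trans hyx
  obtain ⟨M, hM⟩ := exists_lower_bound a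
  have hsx := summable_of_wnorm_ne_top hx ha
  have hs : Summable fun n : ℤ => a.coeff n * y ^ n := by
    refine Summable.of_norm_bounded (hsx.mul_left ((y / x) ^ M)) fun n => ?_
    rw [norm_mul, Real.norm_eq_abs, Real.norm_of_nonneg (zpow_pos hy n).le]
    rcases lt_or_ge n M with hlt | hge
    · simp [hM n hlt]
    · calc |a.coeff n| * y ^ n ≤ |a.coeff n| * ((y / x) ^ M * x ^ n) := by
            gcongr
            exact zpow_le_zpow_div hy hyx hge
        _ = _ := by ring
  have hinj : ∀ n : ℤ, Function.Injective fun j : ℕ => n + (j : ℤ) := fun n i j hij => by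
    simpa using hij
  have hsN : ∀ n : ℤ, Summable fun j : ℕ => a.coeff (n + j) * y ^ j := fun n => by
    have h1 := (hs.comp_injective (hinj n)).mul_left (y ^ (-n))
    refine h1.congr fun j => ?_
    simp only [Function.comp]
    rw [zpow_add₀ hy.ne', zpow_natCast, zpow_neg]
    field_simp
  -- the tail sums `tail n = ∑_{k ≥ n} aₖ y ^ (k - n)`
  let tail : ℤ → ℝ := fun n => ∑' j : ℕ, a.coeff (n + j) * y ^ j
  have htail : ∀ n, tail n = a.coeff n + y * tail (n + 1) := fun n => by
    simp only [tail]
    rw [(hsN n).tsum_eq_zero_add, ← tsum_mul_left]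
    congr 1
    · simp
    · refine tsum_congr fun j => ?_
      rw [show n + ((j + 1 : ℕ) : ℤ) = n + 1 + j by push_cast; ring]
      ring
  have hzero : ∀ n ≤ M, tail n = 0 := fun n hn => by
    have h1 : ∑' j : ℕ, a.coeff (n + j) * y ^ (n + (j : ℤ)) = 0 := by
      rw [← h0]
      refine (hinj n).tsum_eq (f := fun k : ℤ => a.coeff k * y ^ k) fun k hk => ?_
      have : n ≤ k := by
        by_contra hlt
        exact hk (by simp [hM k (by omega)])
      exact ⟨(k - n).toNat, by simp only; omega⟩
    have h2 : y ^ n * tail n = 0 := by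
      rw [← h1, ← tsum_mul_left]
      refine tsum_congr fun j => ?_
      rw [zpow_add₀ hy.ne', zpow_natCast]
      ring
    exact (mul_eq_zero.1 h2).resolve_left (zpow_pos hy n).ne'
  let b : LaurentSeries ℝ := HahnSeries.ofSuppBddBelow (fun n => -(y * tail (n + 1)))
    ⟨M - 1, fun n hn => by
      by_contra hlt
      exact hn (by simp [hzero (n + 1) (by omega)])⟩
  have hb : ∀ n, b.coeff n = -(y * tail (n + 1)) := fun n => rfl
  refine ⟨b, ?_, ?_⟩
  · ext n
    rw [coeff_mul_linear, hb, hb, sub_add_cancel, htail n]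
    field_simp
    ring
  · have hle : ∀ n : ℤ, ENNReal.ofReal (|b.coeff n| * x ^ n) ≤
        ∑' j : ℕ, ENNReal.ofReal ((y / x) ^ (j + 1)) *
          ENNReal.ofReal (|a.coeff (n + (j + 1))| * x ^ (n + (j + 1 : ℤ))) := by
      intro n
      have hsn : Summable fun j : ℕ => |a.coeff (n + 1 + j)| * y ^ j := by
        refine (hsN (n + 1)).norm.congr fun j => ?_
        rw [norm_mul, Real.norm_eq_abs, norm_pow, Real.norm_of_nonneg hy.le]
      have habs : |b.coeff n| ≤ y * ∑' j : ℕ, |a.coeff (n + 1 + j)| * y ^ j := by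
        rw [hb, abs_neg, abs_mul, abs_of_pos hy]
        gcongr
        refine (norm_tsum_le_tsum_norm (hsN (n + 1)).norm).trans_eq (tsum_congr fun j => ?_)
        rw [norm_mul, Real.norm_eq_abs, norm_pow, Real.norm_of_nonneg hy.le]
      have hxn := zpow_pos hx n
      calc ENNReal.ofReal (|b.coeff n| * x ^ n)
          ≤ ENNReal.ofReal (∑' j : ℕ, |a.coeff (n + 1 + j)| * y ^ j * (y * x ^ n)) := by
            rw [tsum_mul_right]
            refine ENNReal.ofReal_le_ofReal ?_
            calc |b.coeff n| * x ^ n ≤ (y * ∑' j : ℕ, |a.coeff (n + 1 + j)| * y ^ j) * x ^ n := by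
                  gcongr
              _ = _ := by ring
        _ = ∑' j : ℕ, ENNReal.ofReal (|a.coeff (n + 1 + j)| * y ^ j * (y * x ^ n)) :=
            ENNReal.ofReal_tsum_of_nonneg (fun j => by positivity) (hsn.mul_right _)
        _ = _ := by
            refine tsum_congr fun j => ?_
            rw [← ENNReal.ofReal_mul (by positivity),
              show n + 1 + (j : ℤ) = n + (j + 1) by ring]
            congr 1
            rw [zpow_add₀ hx.ne', show ((j : ℤ) + 1) = ((j + 1 : ℕ) : ℤ) by push_cast; ring,
              zpow_natCast, div_pow]
            field_simp
            ring
    calc wnorm x b ≤ ∑' n : ℤ, ∑' j : ℕ, ENNReal.ofReal ((y / x) ^ (j + 1)) *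
          ENNReal.ofReal (|a.coeff (n + (j + 1))| * x ^ (n + (j + 1 : ℤ))) :=
        ENNReal.tsum_le_tsum hle
      _ = ∑' j : ℕ, ENNReal.ofReal ((y / x) ^ (j + 1)) * wnorm x a := by
        rw [ENNReal.tsum_comm]
        refine tsum_congr fun j => ?_
        rw [ENNReal.tsum_mul_left]
        congr 1
        exact (Equiv.addRight ((j : ℤ) + 1)).tsum_eq
          fun m => ENNReal.ofReal (|a.coeff m| * x ^ m)
      _ = _ := ENNReal.tsum_mul_right

/-! ### The kernel of evaluation -/

theorem mapCoeff_ofPowerSeries {A B : Type*} [CommRing A] [CommRing B] (φ : A →+* B)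
    (p : PowerSeries A) : mapCoeff φ (HahnSeries.ofPowerSeries ℤ A p) =
      HahnSeries.ofPowerSeries ℤ B (p.map φ) := by
  ext n
  rw [mapCoeff_coeff, PowerSeries.coeff_coe, PowerSeries.coeff_coe]
  split_ifs <;> simp

theorem specialize_mapCoeff_intCast {S : Type*} [TopologicalSpace S] (s : S)
    (f : LaurentSeries ℤ) : specialize s (mapCoeff (Int.castRingHom C(S, ℤ)) f) = f := by
  ext n
  simp

/-- For every `y` there is an integral Laurent series, invertible among all integral Laurent
series, of the form `(1 - T / y) L` where `L` and its inverse `L'` have finite norm for every radius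
below `1`. -/
theorem exists_integral_generator (y : ℝ) :
    ∃ (F F' : LaurentSeries ℤ) (L L' : LaurentSeries ℝ), F * F' = 1 ∧ L * L' = 1 ∧
      mapCoeff (Int.castRingHom ℝ) F = L * (1 - HahnSeries.single 1 y⁻¹) ∧
      ∀ t : ℝ, 0 < t → t < 1 → wnorm t L < ∞ ∧ wnorm t L' < ∞ := by
  obtain ⟨F, L, L', hF1, hLL, hF, hnorm⟩ :=
    exists_integral_multiple (1 + PowerSeries.C (-y⁻¹) * PowerSeries.X ^ (0 + 1))
      (constantCoeff_one_add_monomial _ _)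
  obtain ⟨F', hF'⟩ := (PowerSeries.isUnit_iff_constantCoeff.2
    (hF1 ▸ isUnit_one : IsUnit (PowerSeries.constantCoeff F))).exists_right_inv
  refine ⟨HahnSeries.ofPowerSeries ℤ ℤ F, HahnSeries.ofPowerSeries ℤ ℤ F',
    HahnSeries.ofPowerSeries ℤ ℝ L, HahnSeries.ofPowerSeries ℤ ℝ L', ?_, ?_, ?_, hnorm⟩
  · rw [← map_mul, hF', map_one]
  · rw [← map_mul, hLL, map_one]
  · rw [mapCoeff_ofPowerSeries, hF, map_mul, map_add, map_one, ofPowerSeries_C_mul_X_pow, mul_comm,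
      HahnSeries.single_neg, sub_eq_add_neg]
    simp

/-- Division by the generator: if `a` vanishes at `y`, its quotient by `F = (1 - T / y) L` has norm
bounded by a constant multiple of the norm of `a`. -/
theorem exists_normLE_quotient {y x : ℝ} (hy : 0 < y) (hyx : y < x) {F F' : LaurentSeries ℤ}
    {L L' : LaurentSeries ℝ} (hF : F * F' = 1) (hL : L * L' = 1)
    (hFL : mapCoeff (Int.castRingHom ℝ) F = L * (1 - HahnSeries.single 1 y⁻¹))
    (hfin : wnorm x L' < ∞) {c : ℝ} (hc : 0 < c) :
    ∃ D > 0, ∀ a : LaurentSeries ℤ, NormLE x c a → ∑' n : ℤ, (a.coeff n : ℝ) * y ^ n = 0 →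
      NormLE x D (a * F') := by
  have hx := hy.trans hyx
  set K : ℝ≥0∞ := ∑' j : ℕ, ENNReal.ofReal ((y / x) ^ (j + 1)) with hK
  have hKfin : K ≠ ∞ := ((summable_nat_add_iff 1).2
    (summable_geometric_of_lt_one (by positivity) ((div_lt_one hx).2 hyx))).tsum_ofReal_ne_top
  have hDfin : K * ENNReal.ofReal c * wnorm x L' ≠ ∞ :=
    ENNReal.mul_ne_top (ENNReal.mul_ne_top hKfin ENNReal.ofReal_ne_top) hfin.ne
  refine ⟨(K * ENNReal.ofReal c * wnorm x L').toReal + 1, by positivity, fun a ha h0 => ?_⟩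
  have hbd := (normLE_iff_wnorm_le hx hc.le a).1 ha
  obtain ⟨b, hb, hbnorm⟩ := exists_mul_linear_eq hy hyx (mapCoeff (Int.castRingHom ℝ) a)
    (ne_top_of_le_ne_top ENNReal.ofReal_ne_top hbd) (by simpa using h0)
  have hFF : mapCoeff (Int.castRingHom ℝ) F * mapCoeff (Int.castRingHom ℝ) F' = 1 := by
    rw [← map_mul, hF, map_one]
  have hq : mapCoeff (Int.castRingHom ℝ) (a * F') = b * L' := by
    rw [map_mul, ← hb]
    linear_combination (b * L') * hFF -
      (b * (1 - HahnSeries.single 1 y⁻¹) * mapCoeff (Int.castRingHom ℝ) F') * hL -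
      (b * L' * mapCoeff (Int.castRingHom ℝ) F') * hFL
  rw [normLE_iff_wnorm_le hx (by positivity), hq]
  calc wnorm x (b * L') ≤ wnorm x b * wnorm x L' := wnorm_mul_le hx _ _
    _ ≤ K * ENNReal.ofReal c * wnorm x L' := by
      gcongr
      exact hbnorm.trans (mul_le_mul' le_rfl hbd)
    _ = ENNReal.ofReal (K * ENNReal.ofReal c * wnorm x L').toReal :=
      (ENNReal.ofReal_toReal hDfin).symm
    _ ≤ _ := ENNReal.ofReal_le_ofReal (by linarith)

/-- Existence of the generator of the kernel of evaluation. The space `S` is arbitrary: the quotient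
by the generator has coefficients in `C(S, ℤ)` for algebraic reasons, and only its norm has to be
bounded, point by point. -/
theorem exists_generator (r' r : ℝ) (hr' : 0 < r') (h : r' < r) (hr1 : r < 1) :
    ∃ f : overconvergent r (hr'.trans h), f ∈ nonZeroDivisors (overconvergent r (hr'.trans h)) ∧
      ∀ (S : Type u) [TopologicalSpace S],
        constSection r (hr'.trans h) S f ∈ nonZeroDivisors (sections r (hr'.trans h) S) ∧
        ∀ a : sections r (hr'.trans h) S, evaluation r' r hr' h S a = 0 ↔
          constSection r (hr'.trans h) S f ∣ a := by
  have hr := hr'.trans h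
  obtain ⟨F, F', L, L', hF, hL, hFL, hfin⟩ := exists_integral_generator r'
  have hFne : F ≠ 0 := left_ne_zero_of_mul_eq_one hF
  have hFmem : F ∈ overconvergent r hr := by
    obtain ⟨t, hrt, ht1⟩ := exists_between hr1
    have ht := hr.trans hrt
    have hlin : wnorm t (1 - HahnSeries.single 1 r'⁻¹) ≠ ∞ := by
      rw [sub_eq_add_neg, ← HahnSeries.single_neg]
      refine ne_top_of_le_ne_top ?_ (wnorm_add_le ht _ _)
      rw [wnorm_one, wnorm_single]
      exact ENNReal.add_ne_top.2 ⟨ENNReal.one_ne_top, ENNReal.ofReal_ne_top⟩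
    have hFfin : wnorm t (mapCoeff (Int.castRingHom ℝ) F) ≠ ∞ := by
      rw [hFL]
      exact ne_top_of_le_ne_top (ENNReal.mul_ne_top (hfin t ht ht1).1.ne hlin)
        (wnorm_mul_le ht _ _)
    refine ⟨t, hrt, tendsto_of_normLE (c := (wnorm t (mapCoeff (Int.castRingHom ℝ) F)).toReal) ?_⟩
    rw [normLE_iff_wnorm_le ht ENNReal.toReal_nonneg, ENNReal.ofReal_toReal hFfin]
  have hFzero : ∑' n : ℤ, (F.coeff n : ℝ) * r' ^ n = 0 := by
    have h1 := tsum_coeff_mul_linear hr' L (hfin r' hr' (h.trans hr1)).1.ne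
    rw [← hFL] at h1
    simpa using h1
  refine ⟨⟨F, hFmem⟩, mem_nonZeroDivisors_of_ne_zero fun h0 => hFne (congrArg Subtype.val h0),
    fun S _ => ?_⟩
  have hinv : mapCoeff (Int.castRingHom C(S, ℤ)) F * mapCoeff (Int.castRingHom C(S, ℤ)) F' = 1 := by
    rw [← map_mul, hF, map_one]
  have hval : (constSection r hr S ⟨F, hFmem⟩).1 = mapCoeff (Int.castRingHom C(S, ℤ)) F := rfl
  refine ⟨?_, fun a => ⟨fun ha => ?_, ?_⟩⟩
  · rw [mem_nonZeroDivisors_iff_right]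
    intro x hx
    have hx' : x.1 * mapCoeff (Int.castRingHom C(S, ℤ)) F = 0 := congrArg Subtype.val hx
    refine Subtype.ext ?_
    change x.1 = 0
    linear_combination mapCoeff (Int.castRingHom C(S, ℤ)) F' * hx' - x.1 * hinv
  · obtain ⟨c, hc, hca⟩ := mem_sections_iff.1 a.2
    obtain ⟨D, hD, hq⟩ := exists_normLE_quotient hr' h hF hL hFL (hfin r hr hr1).2 hc
    refine ⟨⟨a.1 * mapCoeff (Int.castRingHom C(S, ℤ)) F', mem_sections_iff.2
      ⟨D, hD, fun s => ?_⟩⟩, Subtype.ext ?_⟩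
    · rw [specialize_mul, specialize_mapCoeff_intCast]
      exact hq _ (hca s) (DFunLike.congr_fun ha s)
    · change a.1 = (constSection r hr S ⟨F, hFmem⟩).1 *
        (a.1 * mapCoeff (Int.castRingHom C(S, ℤ)) F')
      rw [hval]
      linear_combination -a.1 * hinv
  · rintro ⟨b, rfl⟩
    rw [map_mul]
    have h0 : evaluation r' r hr' h S (constSection r hr S ⟨F, hFmem⟩) = 0 := by
      ext s
      change ∑' n : ℤ, ((constSection r hr S ⟨F, hFmem⟩).1.coeff n s : ℝ) * r' ^ n = 0
      simpa using hFzero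
    rw [h0, zero_mul]

/-! ### Surjectivity: expansion in base `r'` -/

/-- On a profinite space a continuous real function can be rounded to a continuous integer-valued
function. -/
theorem exists_continuous_int_near {S : Type*} [TopologicalSpace S] [CompactSpace S] [T2Space S]
    [TotallyDisconnectedSpace S] (g : C(S, ℝ)) : ∃ c : C(S, ℤ), ∀ s, |g s - c s| ≤ 1 := by
  let U : ℤ → TopologicalSpace.Opens S := fun n =>
    ⟨{s | |g s - n| < 1}, isOpen_lt (by fun_prop) continuous_const⟩
  have hU : TopologicalSpace.IsOpenCover U := by
    refine TopologicalSpace.IsOpenCover.mk (eq_top_iff.2 fun s _ => ?_)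
    refine TopologicalSpace.Opens.mem_iSup.2 ⟨round (g s), ?_⟩
    exact (abs_sub_round (g s)).trans_lt (by norm_num)
  obtain ⟨n, W, hW, hcover, hdisj⟩ := hU.exists_finite_nonempty_disjoint_clopen_cover
  choose v hv using fun j => (hW j).2
  choose j hj using fun s : S => Set.mem_iUnion.1 (hcover (Set.mem_univ s))
  have hloc : IsLocallyConstant fun s => v (j s) := by
    rw [IsLocallyConstant.iff_exists_open]
    refine fun s => ⟨W (j s), (W (j s)).isClopen.isOpen, hj s, fun s' hs' => ?_⟩
    by_contra hne
    have hjj : j s' ≠ j s := fun h => hne (by simp only [h])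
    have hd := TopologicalSpace.Clopens.coe_disjoint.2 (hdisj hjj)
    exact Set.disjoint_left.1 hd (hj s') hs'
  exact ⟨⟨_, hloc.continuous⟩, fun s => le_of_lt (hv (j s) (hj s))⟩

theorem hasSum_int_of_nat {M : Type*} [AddCommMonoid M] [TopologicalSpace M] {u : ℤ → M} {x : M}
    (h : HasSum (fun n : ℕ => u n) x) (hu : ∀ n < 0, u n = 0) : HasSum u x := by
  refine (Nat.cast_injective.hasSum_iff (fun n hn => hu n ?_)).1 h
  by_contra hlt
  exact hn ⟨n.toNat, by simpa using hlt⟩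

/-- Every continuous function on a profinite space is `∑ cₙ xⁿ` with uniformly bounded
integer-valued continuous `cₙ`: at each step the rescaled remainder is rounded. -/
theorem exists_expansion {S : Type*} [TopologicalSpace S] [CompactSpace S] [T2Space S]
    [TotallyDisconnectedSpace S] {x : ℝ} (hx0 : 0 < x) (hx1 : x < 1) (g : C(S, ℝ)) :
    ∃ (c : ℕ → C(S, ℤ)) (D : ℝ), (∀ n s, |(c n s : ℝ)| ≤ D) ∧
      ∀ s, HasSum (fun n : ℕ => (c n s : ℝ) * x ^ n) (g s) := by
  choose ρ hρ using fun g : C(S, ℝ) => exists_continuous_int_near g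
  -- the `n`-th remainder, divided by `x ^ n`
  let y : ℕ → C(S, ℝ) := fun n => Nat.rec g (fun _ z =>
    ⟨fun s => (z s - ρ z s) / x, by
      have : Continuous fun s => (ρ z s : ℝ) :=
        continuous_of_discreteTopology.comp (ρ z).continuous
      fun_prop⟩) n
  have hy : ∀ n s, y (n + 1) s = (y n s - ρ (y n) s) / x := fun n s => rfl
  have hbd : ∀ n s, |y n s| ≤ ‖g‖ + x⁻¹ := by
    intro n s
    cases n with
    | zero =>
      have h1 : |g s| ≤ ‖g‖ := g.norm_coe_le_norm s
      have h2 : 0 < x⁻¹ := inv_pos.2 hx0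
      change |g s| ≤ _
      linarith
    | succ n =>
      have h1 : |y (n + 1) s| ≤ x⁻¹ := by
        rw [hy, abs_div, abs_of_pos hx0, div_eq_mul_inv]
        exact mul_le_of_le_one_left (inv_pos.2 hx0).le (hρ (y n) s)
      linarith [norm_nonneg g]
  refine ⟨fun n => ρ (y n), ‖g‖ + x⁻¹ + 1, fun n s => ?_, fun s => ?_⟩
  · have h1 := abs_sub_abs_le_abs_sub (ρ (y n) s : ℝ) (y n s)
    rw [abs_sub_comm] at h1
    linarith [hbd n s, hρ (y n) s]
  · have hpart : ∀ N : ℕ, ∑ n ∈ Finset.range N, (ρ (y n) s : ℝ) * x ^ n = g s - x ^ N * y N s := by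
      intro N
      induction N with
      | zero => simp [y]
      | succ N ih =>
        rw [Finset.sum_range_succ, ih, hy]
        field_simp
        ring
    have hsum : Summable fun n : ℕ => (ρ (y n) s : ℝ) * x ^ n := by
      refine Summable.of_norm_bounded
        ((summable_geometric_of_lt_one hx0.le hx1).mul_left (‖g‖ + x⁻¹ + 1)) fun n => ?_
      rw [norm_mul, norm_pow, Real.norm_of_nonneg hx0.le, Real.norm_eq_abs]
      gcongr
      have h1 := abs_sub_abs_le_abs_sub (ρ (y n) s : ℝ) (y n s)
      rw [abs_sub_comm] at h1
      linarith [hbd n s, hρ (y n) s]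
    rw [hsum.hasSum_iff_tendsto_nat]
    simp only [hpart]
    have hlim : Tendsto (fun N => x ^ N * y N s) atTop (𝓝 0) := by
      refine squeeze_zero_norm (fun N => ?_)
        (by simpa using (tendsto_pow_atTop_nhds_zero_of_lt_one hx0.le hx1).mul_const (‖g‖ + x⁻¹))
      rw [norm_mul, norm_pow, Real.norm_of_nonneg hx0.le, Real.norm_eq_abs]
      gcongr
      exact hbd N s
    simpa using hlim.const_sub (g s)

theorem evaluation_surjective (r' r : ℝ) (hr' : 0 < r') (h : r' < r) (hr1 : r < 1) (S : Type*)
    [TopologicalSpace S] [CompactSpace S] [T2Space S] [TotallyDisconnectedSpace S] :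
    Function.Surjective (evaluation r' r hr' h S) := by
  intro g
  have hr := hr'.trans h
  obtain ⟨c, D, hD, hc⟩ := exists_expansion hr' (h.trans hr1) g
  let a : LaurentSeries C(S, ℤ) := HahnSeries.ofPowerSeries ℤ _ (PowerSeries.mk c)
  have hneg : ∀ n < 0, a.coeff n = 0 := fun n hn => by simp [a, PowerSeries.coeff_coe, hn]
  have hnat : ∀ n : ℕ, a.coeff n = c n := fun n => by simp [a]
  have ha : a ∈ sections r hr S := by
    rw [mem_sections_iff]
    have hgeom := (summable_geometric_of_lt_one hr.le hr1).mul_left D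
    refine ⟨max (∑' n : ℕ, D * r ^ n) 1, by positivity, fun s => ?_⟩
    have hle : ∀ n : ℕ, |(c n s : ℝ)| * r ^ n ≤ D * r ^ n := fun n => by
      gcongr
      exact hD n s
    have hs := Summable.of_nonneg_of_le (fun n => by positivity) hle hgeom
    have hsZ : HasSum (fun n : ℤ => |((specialize s a).coeff n : ℝ)| * r ^ n)
        (∑' n : ℕ, |(c n s : ℝ)| * r ^ n) :=
      hasSum_int_of_nat (by simpa [hnat] using hs.hasSum) fun n hn => by simp [hneg n hn]
    refine ⟨hsZ.summable, ?_⟩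
    rw [hsZ.tsum_eq]
    exact (hs.tsum_le_tsum hle hgeom).trans (le_max_left _ _)
  refine ⟨⟨a, ha⟩, ContinuousMap.ext fun s => ?_⟩
  have hsZ : HasSum (fun n : ℤ => (a.coeff n s : ℝ) * r' ^ n) (g s) :=
    hasSum_int_of_nat (by simpa [hnat] using hc s) fun n hn => by simp [hneg n hn]
  exact hsZ.tsum_eq

/-! ### Exactness of condensed modules -/

theorem exact_of_ker_le_range (R : Type (u + 1)) [Ring R] (S : ShortComplex (CondensedMod.{u} R))
    (hinj : ∀ X : CompHaus.{u}ᵒᵖ, Function.Injective (S.f.hom.app X))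
    (hker : ∀ (X : CompHaus.{u}ᵒᵖ) (y : S.X₂.obj.obj X), S.g.hom.app X y = 0 →
      ∃ x, S.f.hom.app X x = y) : S.Exact := by
  refine S.exact_of_f_is_kernel ?_
  apply Limits.isLimitOfReflects
    (sheafToPresheaf (coherentTopology CompHaus.{u}) (ModuleCat.{u + 1} R))
  apply Limits.evaluationJointlyReflectsLimits
  intro X
  let G : CondensedMod.{u} R ⥤ ModuleCat.{u + 1} R :=
    sheafToPresheaf (coherentTopology CompHaus.{u}) (ModuleCat.{u + 1} R) ⋙
      (CategoryTheory.evaluation _ _).obj X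
  have : G.PreservesZeroMorphisms := ⟨fun _ _ => rfl⟩
  have hmono : Mono (S.map G).f := ConcreteCategory.mono_of_injective _ (hinj X)
  have hex : (S.map G).Exact :=
    (ShortComplex.moduleCat_exact_iff _).2 fun y hy => hker X y hy
  exact (Limits.KernelFork.isLimitMapConeEquiv _ G).symm hex.fIsKernel

theorem shortExact_of_sections (R : Type (u + 1)) [Ring R] (S : ShortComplex (CondensedMod.{u} R))
    [Epi S.g]
    (hinj : ∀ X : CompHaus.{u}ᵒᵖ, Function.Injective (S.f.hom.app X))
    (hker : ∀ (X : CompHaus.{u}ᵒᵖ) (y : S.X₂.obj.obj X), S.g.hom.app X y = 0 →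
      ∃ x, S.f.hom.app X x = y) : S.ShortExact where
  exact := exact_of_ker_le_range R S hinj hker
  mono_f := Sheaf.mono_of_injective _ hinj
  epi_g := inferInstance

end CondensedLaurent

theorem mainTheorem1 (r' r : ℝ) (hr' : 0 < r') (h : r' < r) (hr1 : r < 1) :
    Epi (CondensedLaurent.toAb.map (CondensedLaurent.theta.{u} r' r hr' h)) ∧
    (∀ S : Stonean.{u},
      Function.Surjective ((CondensedLaurent.theta.{u} r' r hr' h).hom.app (op S.compHaus))) ∧
    ∃ f : CondensedLaurent.overconvergent r (hr'.trans h),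
      f ∈ nonZeroDivisors (CondensedLaurent.overconvergent r (hr'.trans h)) ∧
      (∀ S : CompHaus.{u},
        CondensedLaurent.constPoint r (hr'.trans h) f S ∈
          nonZeroDivisors ((CondensedLaurent.laurent.{u} r (hr'.trans h)).obj.obj (op S)) ∧
        RingHom.ker ((CondensedLaurent.theta.{u} r' r hr' h).hom.app (op S)).hom =
          Ideal.span {CondensedLaurent.constPoint r (hr'.trans h) f S}) ∧
      ∃ w : CondensedLaurent.mulConst.{u} r (hr'.trans h) f ≫
          CondensedLaurent.toAb.map (CondensedLaurent.theta.{u} r' r hr' h) = 0,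
        (ShortComplex.mk _ _ w).ShortExact := by
  -- sections of the condensed rings are universe lifts of `sections r _ S` and `C(S, ℝ)`
  have hsurj : ∀ S : Stonean.{u}, Function.Surjective
      ((CondensedLaurent.theta.{u} r' r hr' h).hom.app (op S.compHaus)) := by
    intro S y
    obtain ⟨a, ha⟩ := CondensedLaurent.evaluation_surjective r' r hr' h hr1 S.compHaus y.down
    exact ⟨ULift.up a, congrArg ULift.up ha⟩
  have hepi : Epi (CondensedLaurent.toAb.map (CondensedLaurent.theta.{u} r' r hr' h)) :=
    (CondensedMod.epi_iff_surjective_on_stonean _ _).2 hsurj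
  obtain ⟨f, hf, hS⟩ := CondensedLaurent.exists_generator.{u} r' r hr' h hr1
  refine ⟨hepi, hsurj, f, hf, fun S => ⟨?_, ?_⟩, ?_, ?_⟩
  · rw [mem_nonZeroDivisors_iff_right]
    intro x hx
    exact ULift.ext _ _ ((mem_nonZeroDivisors_iff_right.1 (hS S).1) x.down
      (congrArg ULift.down hx))
  · ext x
    rw [RingHom.mem_ker, Ideal.mem_span_singleton]
    constructor
    · intro hx
      obtain ⟨b, hb⟩ := ((hS S).2 x.down).1 (congrArg ULift.down hx)
      exact ⟨ULift.up b, congrArg ULift.up hb⟩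
    · rintro ⟨b, hb⟩
      exact congrArg ULift.up (((hS S).2 x.down).2 ⟨b.down, congrArg ULift.down hb⟩)
  · ext S x
    exact congrArg ULift.up (((hS S.unop).2 _).2 ⟨x.down, rfl⟩)
  · refine CondensedLaurent.shortExact_of_sections _ _ ?_ ?_
    · intro S x y hxy
      exact ULift.ext _ _ ((mul_cancel_left_mem_nonZeroDivisors (hS S.unop).1).1
        (congrArg ULift.down hxy))
    · intro S y hy
      obtain ⟨b, hb⟩ := ((hS S.unop).2 y.down).1 (congrArg ULift.down hy)
      exact ⟨ULift.up b, congrArg ULift.up hb.symm⟩
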